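/- **Setting.** Let $d\ge 0$, $N_p\ge 1$, $s\ge 0$. Write $H^s=H^s(\mathbb T^d;\mathbb R^{N_p})$ for the periodic Sobolev space of functions $v(x,p_j)$, $x\in\mathbb T^d$, $1\le j\le N_p$, with norm $\big(\sum_k(1+|k|^2)^s\|\hat v(k)\|^2\big)^{1/2}$, and $L^2=L^2(\mathbb T^d;\mathbb R^{N_p})$. For $K\in\mathbb N$, let $I_K=\{k\in\mathbb Z^d:|k|_\infty\le K\}$, let $P_K$ be the projection onto trigonometric polynomials with frequencies in $I_K$, let $F_K v=(\hat v(k))_{k\in I_K}\in(\mathbb C^{N_p})^{I_K}$, and let $F_K^{-1}c=\mathrm{Re}\sum_{k\in I_K}c_k e^{2\pi i\langle k,x\rangle}$. Let $F^p$ be the discrete Fourier transform of length $N_p$, applied to each $c_k$. For an operator $M:H^s\to L^2$, its conjugate maps are $\widehat M_K=F_K\circ M\circ F_K^{-1}$, with components $\widehat M_i$ ($i\in I_K$), and $\widetilde{\widehat M}_K=F^p\circ\widehat M_K\circ(F^p)^{-1}$, with components $\widetilde{\widehat M}_i$. For $V\subset H^s$ put $\hat v=F_KP_Kv$, $\tilde{\hat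 v}=F^p\hat v$, $\hat V=\{\hat v:v\in V\}$, $\tilde{\hat V}=\{\tilde{\hat v}:v\in V\}$, $\hat V_i=\{\hat v_i:v\in V\}$, $\tilde{\hat V}_i=\{\tilde{\hat v}_i:v\in V\}$. Coefficients $c$ are called Hermitian if $c_{-k}=\overline{c_k}$. Let $\sigma:\mathbb R\to\mathbb R$ be Lipschitz and not a polynomial. A *neural network* is a map $y\mapsto C\sigma(Ay+b)$ (one hidden layer of any finite width); complex vectors are fed in and read out through their real and imaginary parts. A *neural operator* on $\mathbb T^d$ is a finite composition of pointwise linear maps of the channels and of layers $$f\mapsto\sigma\Big(f+Wf+\mathrm{Re}\sum_{k\in I_{K'}}\big(R_k\hat f(k)+\beta_k\big)e^{2\pi i\langle k,x\rangle}\Big),$$ with $K'$ arbitrary, $W$ a real matrix, $\beta_k$ complex vectors, and $R_k=A_k$ an arbitrary complex matrix (FNO type), or $R_k=(F^p)^{-1}A_kF^p$ with $F^p$ the DFT along the channel axis (SKNO type). **Theorem.** Let $V\subset H^s$ be compact and $M:H^s\to L^2$ continuous. 0. (Compactness.) For every $K$, the sets $\hat V$, $\tilde{\hat V}$, all $\hat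 V_i$, all $\tilde{\hat V}_i$, and all sets obtained from $\hat V_i$ by setting to zero the entries outside a given set of grid points and then applying $F^p$, are compact. Moreover, if $r>s+\tfrac12$, $p_1,\dots,p_{N_p}\in\mathbb T$, and $\mathcal V\subset H^r(\mathbb T^{d}\times\mathbb T;\mathbb R)$ is compact, then every $v\in\mathcal V$ has a unique sampling $(v(\cdot,p_j))_j\in H^s$ and these samplings form a compact subset of $H^s$ (to which everything below applies). 1. (Equivalence.) For every $K$ the maps $\widehat M_K$ and $\widetilde{\widehat M}_K$ are continuous, and for all $v\in H^s$ $$P_KMP_Kv=F_K^{-1}\widehat M_K F_KP_Kv=F_K^{-1}(F^p)^{-1}\widetilde{\widehat M}_KF^pF_KP_Kv;$$ and $P_KMP_K\to M$ uniformly on $V$ as $K\to\infty$. For every operator $N:H^s\to L^2$ and every $v\in H^s$, $$\|P_KMP_Kv-P_KNP_Kv\|_{L^2}^2=\sum_{i}\|\widehat M_i(\hat v)-\widehat N_i(\hat v)\|^2=\frac1{N_p}\sum_i\|\widetilde{\widehat M}_i(\tilde{\hat v})-\widetilde{\widehat N}_i(\tilde{\hat v})\|^2 .$$ Consequently, for any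 family $(N_a)$ of operators and any filter, $P_KN_aP_K\to P_KMP_K$ uniformly on $V$ iff $\widehat N_{a,i}\to\widehat M_i$ uniformly on $\hat V$ for each $i$, iff $\widetilde{\widehat N}_{a,i}\to\widetilde{\widehat M}_i$ uniformly on $\tilde{\hat V}$ for each $i$. Also, for any classes $\mathcal C_K$ of maps $\Phi:(\mathbb C^{N_p})^{I_K}\to(\mathbb C^{N_p})^{I_K}$ with Hermitian values on $\hat V$, the following are equivalent: (a) for every $\varepsilon>0$ and all large $K$ there is $\Phi\in\mathcal C_K$ with $\sup_{v\in V}\|Mv-F_K^{-1}\Phi F_KP_Kv\|_{L^2}\le\varepsilon$; (b) for every $\varepsilon>0$ and all large $K$ there is $\Phi\in\mathcal C_K$ with $\sup_{\hat V}\|\widehat M_K-\Phi\|\le\varepsilon$; (c) the same as (b) with $\sup_{\tilde{\hat V}}\|\widetilde{\widehat M}_K-F^p\Phi(F^p)^{-1}\|\le\varepsilon$. 2. (Reduction to finite-dimensional networks.) The following holds for neural operators of FNO type and also for those of SKNO type. For all $K$, $R$ and $\varepsilon>0$: - there are neural operators which map each $v\in L^2$ with $\|v\|_{L^2}\le R$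 to a constant function with value within $\varepsilon$ of $F_KP_Kv$, respectively of $F^pF_KP_Kv$; - there are neural operators which map each constant function with value $c$, $\|c\|\le R$, to a function within $\varepsilon$ in $L^2$ of $F_K^{-1}c$, respectively of $F_K^{-1}(F^p)^{-1}c$; - for each $i$ there are neural networks within $\varepsilon$ of $\widehat M_i$ on $\hat V$, respectively of $\widetilde{\widehat M}_i$ on $\tilde{\hat V}$; - if $\widehat M_i(\hat v)=m_i(\hat v_i)$ for all $v\in V$ and all $i\in I_K$, i.e. the conjugate map acts mode by mode as $m_i:\hat V_i\to\mathbb C^{N_p}$, then there are neural networks $\Phi_i$ on $\mathbb R^{2N_p}$ within $\varepsilon$ of $m_i$ on $\hat V_i$ such that also $\|P_KMP_Kv-F_K^{-1}(\Phi_i(\hat v_i))_i\|_{L^2}\le\varepsilon$ on $V$; the same holds for $\widetilde{\widehat M}_i$, $\tilde{\hat V}_i$ and $F_K^{-1}(F^p)^{-1}$. In particular, for every $\varepsilon>0$ and all sufficiently large $K$ there are a neural operator within $\varepsilon$ of the forward transform $F_KP_K$ on $V$, a neural network within $\varepsilon$ of $\widehat M_K$ on $\hat V$, and a neural operator within $\varepsilon$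 of $F_K^{-1}$ on $\widehat M_K(\hat V)$ (in the senses above), whose composition is a neural operator $\mathcal N$ with $\sup_{v\in V}\|Mv-\mathcal Nv\|_{L^2}\le\varepsilon$. The same holds with the additional DFT in $p$, i.e. with $F^pF_KP_K$, $\widetilde{\widehat M}_K$ on $\tilde{\hat V}$, and $F_K^{-1}(F^p)^{-1}$ on $\widetilde{\widehat M}_K(\tilde{\hat V})$. -/

import Mathlib

open MeasureTheory Filter Topology
open scoped ENNReal

noncomputable section

namespace SKNO

/-! ### Functions on the torus and their Fourier coefficients -/

/-- The physical domain: the `d`-dimensional unit torus. -/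
abbrev Torus (d : ℕ) := UnitAddTorus (Fin d)

/-- The normalised Haar (probability) measure of the torus. -/
abbrev haarT (d : ℕ) : Measure (Torus d) := Measure.pi fun _ => AddCircle.haarAddCircle

/-- Square-integrable functions `x ↦ (v(x, p))_{p ∈ ι}` with real values, where `ι` is a finite
set of channels (for instance a grid in the auxiliary variable `p`). -/
abbrev L2 (d : ℕ) (ι : Type) [Fintype ι] := Lp (EuclideanSpace ℝ ι) 2 (haarT d)

/-- The `k`-th Fourier coefficient in `x` of a function with real channels. -/
def coeff {d : ℕ} {ι : Type} (f : Torus d → EuclideanSpace ℝ ι) (k : Fin d → ℤ) :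
    EuclideanSpace ℂ ι :=
  WithLp.toLp 2 fun j => UnitAddTorus.mFourierCoeff (fun x => ((f x j : ℝ) : ℂ)) k

/-- The Sobolev weight `1 + |k|²`. -/
def sobWeight {d : ℕ} (k : Fin d → ℤ) : ℝ := 1 + ∑ j, (k j : ℝ) ^ 2

/-- The periodic Sobolev space `H^s(𝕋^d; ℝ^ι)`: square-integrable functions for which
`∑_k (1 + |k|²)^s ‖v̂(k)‖²` is finite. -/
structure Sob (d : ℕ) (s : ℝ) (ι : Type) [Fintype ι] where
  /-- the underlying square-integrable function -/
  toL2 : L2 d ι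
  /-- finiteness of the Sobolev norm -/
  mem : Memℓp (E := fun _ : Fin d → ℤ => EuclideanSpace ℂ ι)
    (fun k => ((sobWeight k ^ (s / 2) : ℝ) : ℂ) • coeff toL2 k) 2

/-- The sequence of weighted Fourier coefficients; its `ℓ²`-norm is the Sobolev norm. -/
def Sob.weighted {d : ℕ} {s : ℝ} {ι : Type} [Fintype ι] (v : Sob d s ι) :
    lp (fun _ : Fin d → ℤ => EuclideanSpace ℂ ι) 2 :=
  ⟨fun k => ((sobWeight k ^ (s / 2) : ℝ) : ℂ) • coeff v.toL2 k, v.mem⟩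

/-- The distance `‖u - v‖_{H^s}`. -/
instance {d : ℕ} {s : ℝ} {ι : Type} [Fintype ι] : PseudoMetricSpace (Sob d s ι) :=
  PseudoMetricSpace.induced Sob.weighted inferInstance

/-! ### Truncation, discrete transforms -/

/-- The retained Fourier modes: integer vectors with all entries in `[-K, K]`. -/
abbrev Modes (d K : ℕ) := Fin d → Finset.Icc (-(K : ℤ)) (K : ℤ)

/-- The frequency of a retained mode. -/
def freq {d K : ℕ} (i : Modes d K) : Fin d → ℤ := fun j => (i j : ℤ)

/-- The finite-dimensional coefficient space: one vector in `ℂ^ι` for each retained mode. -/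
abbrev Coeff (d K : ℕ) (ι : Type) [Fintype ι] :=
  PiLp 2 fun _ : Modes d K => EuclideanSpace ℂ ι

/-- The truncated Fourier transform `F^x_K`. -/
def fwd {d : ℕ} (K : ℕ) {ι : Type} [Fintype ι] (f : Torus d → EuclideanSpace ℝ ι) :
    Coeff d K ι :=
  WithLp.toLp 2 fun i => coeff f (freq i)

/-- The real trigonometric polynomial `Re ∑_i c_i e^{2πi⟨k_i, x⟩}`. -/
def synthFun {d K : ℕ} {ι : Type} [Fintype ι] (c : Coeff d K ι) (x : Torus d) :
    EuclideanSpace ℝ ι :=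
  WithLp.toLp 2 fun j => (∑ i, c i j * UnitAddTorus.mFourier (freq i) x).re

theorem continuous_synthFun {d K : ℕ} {ι : Type} [Fintype ι] (c : Coeff d K ι) :
    Continuous (synthFun c) := by
  unfold synthFun
  fun_prop

/-- The inverse transform `(F^x_K)⁻¹`, with values in square-integrable functions. -/
def synth {d K : ℕ} {ι : Type} [Fintype ι] (c : Coeff d K ι) : L2 d ι :=
  ContinuousMap.toLp 2 (haarT d) ℝ ⟨synthFun c, continuous_synthFun c⟩

theorem coeFn_synth {d K : ℕ} {ι : Type} [Fintype ι] (c : Coeff d K ι) :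
    synth c =ᵐ[haarT d] synthFun c :=
  ContinuousMap.coeFn_toLp (haarT d) ⟨synthFun c, continuous_synthFun c⟩

theorem coeff_congr {d : ℕ} {ι : Type} {f g : Torus d → EuclideanSpace ℝ ι}
    (h : f =ᵐ[haarT d] g) (k : Fin d → ℤ) : coeff f k = coeff g k := by
  unfold coeff
  congr 1
  funext j
  refine integral_congr_ae ?_
  filter_upwards [h] with x hx
  rw [hx]

theorem integral_mFourier {d : ℕ} {n : Fin d → ℤ} (hn : n ≠ 0) :
    ∫ x, UnitAddTorus.mFourier n x ∂(haarT d) = 0 := by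
  have h := (UnitAddTorus.orthonormal_mFourier (d := Fin d)).2 (i := 0) (j := n) (Ne.symm hn)
  have h' := ContinuousMap.inner_toLp (𝕜 := ℂ) (μ := haarT d)
    (UnitAddTorus.mFourier (0 : Fin d → ℤ)) (UnitAddTorus.mFourier n)
  have h2 := h'.symm.trans h
  simpa [UnitAddTorus.mFourier_zero] using h2

theorem coeff_synthFun_of_notMem {d K : ℕ} {ι : Type} [Fintype ι] (c : Coeff d K ι)
    {k : Fin d → ℤ} (hk : ∃ j, k j ∉ Finset.Icc (-(K : ℤ)) (K : ℤ)) :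
    coeff (synthFun c) k = 0 := by
  obtain ⟨l, hl⟩ := hk
  ext j
  have hint : ∀ n : Fin d → ℤ, Integrable (fun x => UnitAddTorus.mFourier n x) (haarT d) := by
    intro n
    exact (UnitAddTorus.mFourier n).continuous.integrable_of_hasCompactSupport
      (HasCompactSupport.of_compactSpace _)
  have h1 : ∀ i : Modes d K, -k + freq i ≠ 0 := by
    intro i h0
    apply hl
    have := congrFun h0 l
    have h3 : k l = (i l : ℤ) := by simp [freq] at this; omega
    rw [h3]; exact (i l).2
  have h2 : ∀ i : Modes d K, -k + -freq i ≠ 0 := by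
    intro i h0
    apply hl
    have := congrFun h0 l
    have h3 : k l = -(i l : ℤ) := by simp [freq] at this; omega
    have h4 := (i l).2
    rw [Finset.mem_Icc] at h4 ⊢
    omega
  have key : ∀ x : Torus d, UnitAddTorus.mFourier (-k) x • (((synthFun c x) j : ℝ) : ℂ)
      = ∑ i, ((c i j / 2) * UnitAddTorus.mFourier (-k + freq i) x
        + ((starRingEnd ℂ) (c i j) / 2) * UnitAddTorus.mFourier (-k + -freq i) x) := by
    intro x
    simp only [synthFun, UnitAddTorus.mFourier_add, UnitAddTorus.mFourier_neg, smul_eq_mul]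
    rw [Complex.re_eq_add_conj, map_sum, ← Finset.sum_add_distrib, Finset.sum_div,
      Finset.mul_sum]
    refine Finset.sum_congr rfl fun i _ => ?_
    rw [map_mul]
    ring
  change ∫ x, UnitAddTorus.mFourier (-k) x • (((synthFun c x) j : ℝ) : ℂ) ∂(haarT d) = 0
  simp_rw [key]
  rw [integral_finsetSum]
  · refine Finset.sum_eq_zero fun i _ => ?_
    rw [integral_add ((hint _).const_mul _) ((hint _).const_mul _), integral_const_mul,
      integral_const_mul, integral_mFourier (h1 i), integral_mFourier (h2 i)]
    simp
  · intro i _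
    exact ((hint _).const_mul _).add ((hint _).const_mul _)

theorem synth_mem {d K : ℕ} {ι : Type} [Fintype ι] (s : ℝ) (c : Coeff d K ι) :
    Memℓp (E := fun _ : Fin d → ℤ => EuclideanSpace ℂ ι)
      (fun k => ((sobWeight k ^ (s / 2) : ℝ) : ℂ) • coeff (synth c) k) 2 := by
  have key : {k : Fin d → ℤ |
      ((sobWeight k ^ (s / 2) : ℝ) : ℂ) • coeff (synth c) k ≠ 0}.Finite := by
    refine Set.Finite.subset (Set.finite_range (freq : Modes d K → Fin d → ℤ)) ?_
    intro k hk
    by_contra hc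
    apply hk
    have : ∃ j, k j ∉ Finset.Icc (-(K : ℤ)) (K : ℤ) := by
      by_contra hall
      push Not at hall
      exact hc ⟨fun j => ⟨k j, hall j⟩, rfl⟩
    simp only [coeff_congr (coeFn_synth c), coeff_synthFun_of_notMem c this, smul_zero]
  exact (memℓp_zero (E := fun _ : Fin d → ℤ => EuclideanSpace ℂ ι) key).of_exponent_ge
    (show (0 : ℝ≥0∞) ≤ 2 by norm_num)

/-- The inverse transform `(F^x_K)⁻¹`, with values in the Sobolev space. -/
def synthSob {d K : ℕ} {ι : Type} [Fintype ι] (s : ℝ) (c : Coeff d K ι) : Sob d s ι :=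
  ⟨synth c, synth_mem s c⟩

/-- The spectral projection `P^x_K` of the Sobolev space onto trigonometric polynomials. -/
def proj {d : ℕ} {s : ℝ} {ι : Type} [Fintype ι] (K : ℕ) (v : Sob d s ι) : Sob d s ι :=
  synthSob s (fwd K v.toL2)

/-- The spectral projection `P^x_K` on square-integrable functions. -/
def projL2 {d : ℕ} {ι : Type} [Fintype ι] (K : ℕ) (w : L2 d ι) : L2 d ι :=
  synth (fwd K w)

/-- The truncated Fourier representative `v̂ = F^x_K [P^x_K v]`; its `i`-th entry is the vector
`v̂_i ∈ ℂ^{N_p}`. -/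
def spec {d : ℕ} {s : ℝ} {ι : Type} [Fintype ι] (K : ℕ) (v : Sob d s ι) : Coeff d K ι :=
  fwd K (proj K v).toL2

/-- The discrete Fourier transform `F^p` in the auxiliary variable, at one mode. -/
def dftP {n : ℕ} [NeZero n] (z : EuclideanSpace ℂ (ZMod n)) : EuclideanSpace ℂ (ZMod n) :=
  WithLp.toLp 2 (ZMod.dft (WithLp.ofLp z))

/-- The discrete Fourier transform `F^p` in the auxiliary variable, at all modes. -/
def pDFT {d K n : ℕ} [NeZero n] (c : Coeff d K (ZMod n)) : Coeff d K (ZMod n) :=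
  WithLp.toLp 2 fun i => dftP (c i)

/-- The inverse discrete Fourier transform `(F^p)⁻¹` in the auxiliary variable. -/
def pDFTInv {d K n : ℕ} [NeZero n] (c : Coeff d K (ZMod n)) : Coeff d K (ZMod n) :=
  WithLp.toLp 2 fun i => WithLp.toLp 2 (ZMod.dft.symm (WithLp.ofLp (c i)))

/-- The coordinate dropout `R^p`: only the grid points of `S` are kept. -/
def dropout {n : ℕ} (S : Finset (ZMod n)) (z : EuclideanSpace ℂ (ZMod n)) :
    EuclideanSpace ℂ (ZMod n) :=
  WithLp.toLp 2 fun j => if j ∈ S then z j else 0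

/-- The conjugate map `M̂_K = F^x_K ∘ M ∘ (F^x_K)⁻¹` of an operator `M`; its `i`-th component
is `M̂_i`. -/
def conjMap {d : ℕ} {s : ℝ} {ι : Type} [Fintype ι] (K : ℕ) (M : Sob d s ι → L2 d ι)
    (c : Coeff d K ι) : Coeff d K ι :=
  fwd K (M (synthSob s c))

/-- The conjugate map after a further transform in the auxiliary variable,
`F^p ∘ M̂_K ∘ (F^p)⁻¹`. -/
def conjMapP {d : ℕ} {s : ℝ} {n : ℕ} [NeZero n] (K : ℕ)
    (M : Sob d s (ZMod n) → L2 d (ZMod n)) (c : Coeff d K (ZMod n)) : Coeff d K (ZMod n) :=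
  pDFT (conjMap K M (pDFTInv c))

/-- The operator `(F^x_K)⁻¹ ∘ Φ ∘ F^x_K ∘ P^x_K` built from a map `Φ` of coefficients. -/
def coeffOp {d : ℕ} {s : ℝ} {ι : Type} [Fintype ι] {K : ℕ} (Φ : Coeff d K ι → Coeff d K ι)
    (v : Sob d s ι) : L2 d ι :=
  synth (Φ (spec K v))

/-- Coefficients of real trigonometric polynomials: opposite modes carry conjugate values. -/
def IsHermitian {d K : ℕ} {ι : Type} [Fintype ι] (c : Coeff d K ι) : Prop :=
  ∀ i i' : Modes d K, freq i' = -freq i → ∀ j, c i' j = (starRingEnd ℂ) (c i j)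

/-! ### Sampling in the auxiliary variable -/

/-- `v'` consists of the restrictions `x ↦ v(x, p_j)` of a function `v` on `𝕋^d × 𝕋` to the grid
points `p_j`, expressed through Fourier coefficients in `x`. -/
def IsSampling {d n : ℕ} {r s : ℝ} [NeZero n] (p : ZMod n → UnitAddCircle)
    (v : Sob (d + 1) r Unit) (v' : Sob d s (ZMod n)) : Prop :=
  ∀ (k : Fin d → ℤ) (j : ZMod n),
    HasSum (fun m : ℤ => coeff v.toL2 (Fin.snoc k m) () * fourier m (p j)) (coeff v'.toL2 k j)

/-! ### Neural networks and neural operators -/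

/-- The real vector of real and imaginary parts of a complex vector (`ℂ^κ = ℝ^{2κ}`). -/
def realify {κ : Type} (z : EuclideanSpace ℂ κ) : EuclideanSpace ℝ (κ × Bool) :=
  WithLp.toLp 2 fun a => if a.2 then (z a.1).im else (z a.1).re

/-- The inverse of `realify`. -/
def complexify {κ : Type} (y : EuclideanSpace ℝ (κ × Bool)) : EuclideanSpace ℂ κ :=
  WithLp.toLp 2 fun j => ⟨y (j, false), y (j, true)⟩

/-- The real vector of all real and imaginary parts of a family of coefficients. -/
def enc {d K : ℕ} {ι : Type} [Fintype ι] (c : Coeff d K ι) :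
    EuclideanSpace ℝ ((Modes d K × ι) × Bool) :=
  realify (WithLp.toLp 2 fun a : Modes d K × ι => c a.1 a.2)

/-- A fully connected neural network with one hidden layer of `width + 1` units, from `ℝ^ι` to
`ℝ^κ`. -/
structure NN (ι κ : Type) where
  /-- one less than the number of hidden units -/
  width : ℕ
  /-- input weights -/
  A : Matrix (ZMod (width + 1)) ι ℝ
  /-- biases -/
  b : ZMod (width + 1) → ℝ
  /-- output weights -/
  C : Matrix κ (ZMod (width + 1)) ℝ

/-- The map `y ↦ C σ(A y + b)` computed by a network. -/
def NN.eval {ι κ : Type} [Fintype ι] (σ : ℝ → ℝ) (Φ : NN ι κ) (y : EuclideanSpace ℝ ι) :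
    EuclideanSpace ℝ κ :=
  WithLp.toLp 2 (Φ.C.mulVec fun h => σ (Φ.A.mulVec (WithLp.ofLp y) h + Φ.b h))

/-- The two spectral architectures. In both, learnable matrices act on the channels at every
retained frequency in `x`. They are applied directly in `fno`, and between a further discrete
Fourier transform along the channel axis `p` and its inverse in `skno`. -/
inductive Arch
  | fno
  | skno

/-- The action on the channel axis at one frequency in `x`. -/
def Arch.mul (arch : Arch) {n : ℕ} [NeZero n] (A : Matrix (ZMod n) (ZMod n) ℂ)
    (z : ZMod n → ℂ) : ZMod n → ℂ :=
  match arch with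
  | .fno => A.mulVec z
  | .skno => ZMod.dft.symm (A.mulVec (ZMod.dft z))

/-- Neural operators on the `d`-dimensional torus, from functions with channels `ι` to functions
with channels `κ`: finite compositions of pointwise linear maps of the channels (lifting,
recovering) and of nonlinear layers `σ ∘ (I + W + 𝒦)`. -/
inductive NeuralOp (d : ℕ) : Type → Type → Type 1
  | lin {ι κ : Type} [Fintype ι] (A : Matrix κ ι ℝ) : NeuralOp d ι κ
  /-- A nonlinear layer: residual weights `W`, frequency cut-off `K`, spectral weights `A`, and
  the Fourier coefficients `β` of a bias function. -/
  | layer (n : ℕ) [NeZero n] (W : Matrix (ZMod n) (ZMod n) ℝ) (K : ℕ)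
      (A : Modes d K → Matrix (ZMod n) (ZMod n) ℂ) (β : Modes d K → ZMod n → ℂ) :
      NeuralOp d (ZMod n) (ZMod n)
  | comp {ι κ μ : Type} (N : NeuralOp d ι κ) (N' : NeuralOp d κ μ) : NeuralOp d ι μ

/-- The action of a neural operator on functions, for the activation `σ`. In a composition the
first operator acts first. -/
def NeuralOp.eval (σ : ℝ → ℝ) (arch : Arch) {d : ℕ} : {ι κ : Type} → NeuralOp d ι κ →
    (Torus d → ι → ℝ) → Torus d → κ → ℝ
  | _, _, @NeuralOp.lin _ _ _ _ A, f => fun x => A.mulVec (f x)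
  | _, _, @NeuralOp.layer _ _ _ W _ A β, f => fun x j =>
      σ (f x j + W.mulVec (f x) j +
        (∑ i, (arch.mul (A i)
            (fun l => UnitAddTorus.mFourierCoeff (fun y => ((f y l : ℝ) : ℂ)) (freq i)) j
          + β i j) * UnitAddTorus.mFourier (freq i) x).re)
  | _, _, .comp N N', f => N'.eval σ arch (N.eval σ arch f)

/-- The neural operator acting on channel vectors with values in Euclidean space. -/
def NeuralOp.app (σ : ℝ → ℝ) (arch : Arch) {d : ℕ} {ι κ : Type} (N : NeuralOp d ι κ)
    (f : Torus d → EuclideanSpace ℝ ι) (x : Torus d) : EuclideanSpace ℝ κ :=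
  WithLp.toLp 2 (N.eval σ arch (fun y => WithLp.ofLp (f y)) x)

/-- A neural network applied at every point is a neural operator. -/
def NN.toOp {ι κ : Type} [Fintype ι] (d : ℕ) (Φ : NN ι κ) : NeuralOp d ι κ :=
  .comp (.lin Φ.A) (.comp (.layer (Φ.width + 1) 0 0 0 (fun _ j => (Φ.b j : ℂ))) (.lin Φ.C))

theorem NN.toOp_app (σ : ℝ → ℝ) (arch : Arch) {ι κ : Type} [Fintype ι] (d : ℕ) (Φ : NN ι κ)
    (f : Torus d → EuclideanSpace ℝ ι) (x : Torus d) :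
    (Φ.toOp d).app σ arch f x = Φ.eval σ (f x) := by
  have hz : ∀ {n : ℕ} [NeZero n] (z : ZMod n → ℂ),
      arch.mul (0 : Matrix (ZMod n) (ZMod n) ℂ) z = 0 := by
    intro n _ z
    cases arch <;> simp [Arch.mul]
  have hf : ∀ i : Modes d 0, freq i = 0 := by
    intro i
    funext j
    have := (i j).2
    simp only [Nat.cast_zero, neg_zero, Finset.Icc_self, Finset.mem_singleton] at this
    simpa [freq] using this
  have hu : Fintype.card (Modes d 0) = 1 := by simp [Modes]
  simp only [NN.toOp, NeuralOp.app, NeuralOp.eval, NN.eval]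
  congr 2
  funext h
  simp [hz, hf, UnitAddTorus.mFourier_zero]

/-- `N` computes the transform `T` of its input up to `ε` on `V`: its output is a constant function
whose value is `ε`-close to the vector of coefficients `T v`. -/
def ComputesCoeff (σ : ℝ → ℝ) (arch : Arch) {d K n : ℕ} [NeZero n]
    (N : NeuralOp d (ZMod n) ((Modes d K × ZMod n) × Bool))
    (V : Set (L2 d (ZMod n))) (T : L2 d (ZMod n) → Coeff d K (ZMod n)) (ε : ℝ) : Prop :=
  ∀ v ∈ V, ∃ y, (N.app σ arch v =ᵐ[haarT d] fun _ => y) ∧ ‖y - enc (T v)‖ ≤ ε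

/-- `N` computes the synthesis `T` up to `ε` on `C`: on the constant function with value `c` its
output is `ε`-close to `T c` in the `L²`-norm. -/
def ComputesFun (σ : ℝ → ℝ) (arch : Arch) {d K n : ℕ} [NeZero n]
    (N : NeuralOp d ((Modes d K × ZMod n) × Bool) (ZMod n))
    (C : Set (Coeff d K (ZMod n))) (T : Coeff d K (ZMod n) → L2 d (ZMod n)) (ε : ℝ) : Prop :=
  ∀ c ∈ C, eLpNorm (fun x => N.app σ arch (fun _ => enc c) x - T c x) 2 (haarT d)
    ≤ ENNReal.ofReal ε

end SKNO

end

open SKNO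

noncomputable section

namespace SKNO

/-! ### Fourier coefficients of real vector-valued functions and Parseval's identity -/

section

variable {d : ℕ} {ι : Type}

/-! The equivalence statements are consequences of Parseval's identity. `synth` takes a real part,
so it is an isometry on Hermitian coefficients (`norm_synth`); the conjugate maps always have
Hermitian values, because they are coefficients of real functions. Hence the `L²` distance of two
truncated operators is exactly the distance of their conjugate maps, and the unnormalised transform
in `p` only multiplies distances by `√n` (`norm_pDFT`). Spectral projections are contractions of
`H^s` and of `L²` that converge strongly to the identity. With continuity of `M` and compactness of
`V` this gives uniform convergence of the truncated operators (`tendstoUniformlyOn_projL2_proj`),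
and so passes from `P_K M P_K` to `M` itself.

Universal approximation (`NN.exists_eval_approx`) works in the closed span `S` of the functions `σ(ℓ
+ b)`, with `ℓ` linear, on a compact set. Mollifying `σ` only averages over the bias `b`, so ridge
functions of smooth mollifications lie in `S`. Differentiating `k` times in the inner weight `a` at
`a = 0` produces `ℓ ^ k` times a `k`-th derivative at `b`. This derivative can be made nonzero:
otherwise all mollifications would be polynomials of degree less than `k`, and so would be their
limit `σ`. Thus `S` contains all powers of `ℓ`, hence `exp ℓ`. Exponentials of linear forms are
closed under products and separate points, so Stone–Weierstrass gives density.

For neural operators the point is that a layer returns a coefficient only modulated by its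
exponential `e_k` and passed through `σ`. The residual weight `W = -1` cancels the identity, leaving
`σ` of a trigonometric polynomial whose coefficients are affine in those of the input
(`NeuralOp.exists_eval_spectral`). One layer can thus feed a pointwise network with `v̂(k) e_k` and,
through the bias, with `e_k`. As `|e_k| = 1`, multiplication by the conjugate of `e_k` recovers
`v̂(k)`; the network approximates this product, and averaging over the torus makes the output
exactly constant (`NeuralOp.exists_approx_forward`). The inverse transform multiplies a constant
input by the `e_k` in the same way (`NeuralOp.exists_approx_inverse`). Conjugation by the transform
in `p` is a bijection of matrices, so both architectures have the same layers
(`Arch.exists_mul_eq`).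

Sampling in `p` is a trace theorem: Cauchy–Schwarz in the last frequency makes it Lipschitz from
`H^r` to `H^s` when `r > s + 1/2`, so compactness is preserved. -/

theorem coeff_apply (f : Torus d → EuclideanSpace ℝ ι) (k : Fin d → ℤ) (j : ι) :
    coeff f k j = ∫ x, UnitAddTorus.mFourier (-k) x * ((f x j : ℝ) : ℂ) ∂(haarT d) := rfl

theorem coeff_neg_apply (f : Torus d → EuclideanSpace ℝ ι) (k : Fin d → ℤ) (j : ι) :
    coeff f (-k) j = (starRingEnd ℂ) (coeff f k j) := by
  rw [coeff_apply, coeff_apply, ← integral_conj]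
  simp [UnitAddTorus.mFourier_neg]

theorem integral_mFourier_eq_ite (n : Fin d → ℤ) :
    ∫ x, UnitAddTorus.mFourier n x ∂(haarT d) = if n = 0 then 1 else 0 := by
  split_ifs with h
  · subst h
    simp [UnitAddTorus.mFourier_zero]
  · exact integral_mFourier h

theorem integrable_mFourier (n : Fin d → ℤ) :
    Integrable (fun x => UnitAddTorus.mFourier n x) (haarT d) :=
  (UnitAddTorus.mFourier n).continuous.integrable_of_hasCompactSupport
    (HasCompactSupport.of_compactSpace _)

variable [Fintype ι]

/-- The Hilbert basis of exponentials. -/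
def expBasis (d : ℕ) : HilbertBasis (Fin d → ℤ) ℂ (Lp ℂ 2 (haarT d)) :=
  UnitAddTorus.mFourierBasis

theorem expBasis_repr (f : Lp ℂ 2 (haarT d)) (k : Fin d → ℤ) :
    (expBasis d).repr f k = ∫ x, UnitAddTorus.mFourier (-k) x * f x ∂(haarT d) :=
  UnitAddTorus.mFourierBasis_repr f k

/-- One channel of a real vector-valued function, as a complex-valued function. -/
def channel (j : ι) : L2 d ι →L[ℝ] Lp ℂ 2 (haarT d) :=
  (Complex.ofRealCLM ∘L (EuclideanSpace.proj j : EuclideanSpace ℝ ι →L[ℝ] ℝ)).compLpL 2 (haarT d)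

theorem coeFn_channel (j : ι) (v : L2 d ι) :
    channel j v =ᵐ[haarT d] fun x => ((v x j : ℝ) : ℂ) :=
  ContinuousLinearMap.coeFn_compLp
    (Complex.ofRealCLM ∘L (EuclideanSpace.proj j : EuclideanSpace ℝ ι →L[ℝ] ℝ)) v

theorem coeff_eq_repr (v : L2 d ι) (k : Fin d → ℤ) (j : ι) :
    coeff v k j = (expBasis d).repr (channel j v) k := by
  rw [expBasis_repr, coeff_apply]
  refine integral_congr_ae ?_
  filter_upwards [coeFn_channel j v] with x hx
  rw [hx]

theorem coeff_add (u v : L2 d ι) (k : Fin d → ℤ) :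
    coeff (u + v : L2 d ι) k = coeff u k + coeff v k := by
  ext j
  rw [PiLp.add_apply, coeff_eq_repr, coeff_eq_repr, coeff_eq_repr, map_add, map_add]
  rfl

theorem coeff_sub (u v : L2 d ι) (k : Fin d → ℤ) :
    coeff (u - v : L2 d ι) k = coeff u k - coeff v k := by
  ext j
  rw [PiLp.sub_apply, coeff_eq_repr, coeff_eq_repr, coeff_eq_repr, map_sub, map_sub]
  rfl

theorem hasSum_norm_sq_repr (g : Lp ℂ 2 (haarT d)) :
    HasSum (fun k => ‖(expBasis d).repr g k‖ ^ 2) (‖g‖ ^ 2) := by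
  have h := lp.hasSum_norm (p := 2) (by norm_num) ((expBasis d).repr g)
  simpa using h

theorem norm_sq_eq_sum_channel (v : L2 d ι) : ‖v‖ ^ 2 = ∑ j, ‖channel j v‖ ^ 2 := by
  have h1 : ‖v‖ ^ 2 = ∫ x, ‖v x‖ ^ 2 ∂(haarT d) := by
    rw [← real_inner_self_eq_norm_sq, L2.inner_def]
    simp
  have h2 : ∀ j, ‖channel j v‖ ^ 2 = ∫ x, (v x j) ^ 2 ∂(haarT d) := by
    intro j
    have := inner_self_eq_norm_sq (𝕜 := ℂ) (channel j v)
    rw [← this, L2.inner_def]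
    have h3 : ∫ x, inner ℂ (channel j v x) (channel j v x) ∂(haarT d)
        = ∫ x, (((v x j) ^ 2 : ℝ) : ℂ) ∂(haarT d) := by
      refine integral_congr_ae ?_
      filter_upwards [coeFn_channel j v] with x hx
      rw [hx, RCLike.inner_apply, Complex.conj_ofReal]
      push_cast
      ring
    rw [h3]
    exact congrArg Complex.re (integral_ofReal (𝕜 := ℂ))
  rw [h1]
  simp_rw [h2, EuclideanSpace.norm_sq_eq, Real.norm_eq_abs, sq_abs]
  rw [integral_finsetSum]
  intro j _
  have := (Lp.memLp v).eval_piLp j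
  exact this.integrable_sq

/-- Scalar Parseval in each complexified channel, summed over the finitely many channels.
Uniqueness, the bounds on coefficients and the isometry of synthesis all rest on it. -/
theorem hasSum_norm_sq_coeff (v : L2 d ι) :
    HasSum (fun k => ‖coeff v k‖ ^ 2) (‖v‖ ^ 2) := by
  rw [norm_sq_eq_sum_channel]
  simp_rw [EuclideanSpace.norm_sq_eq, coeff_eq_repr]
  exact hasSum_sum fun j _ => hasSum_norm_sq_repr _

theorem L2.ext_coeff {u v : L2 d ι} (h : ∀ k, coeff u k = coeff v k) : u = v := by
  have h1 := hasSum_norm_sq_coeff (u - v)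
  simp only [coeff_sub, h, sub_self, norm_zero] at h1
  have h0 : HasSum (fun _ : Fin d → ℤ => (0 : ℝ) ^ 2) 0 := by
    rw [zero_pow two_ne_zero]
    exact hasSum_zero
  have h2 := h1.unique h0
  simpa [sub_eq_zero] using h2

theorem norm_coeff_le (v : L2 d ι) (k : Fin d → ℤ) : ‖coeff v k‖ ≤ ‖v‖ := by
  have := le_hasSum (hasSum_norm_sq_coeff v) k fun _ _ => by positivity
  exact le_of_sq_le_sq this (norm_nonneg _)

/-- Square-summable coefficients with conjugate values at opposite frequencies are those of a real
function. -/
theorem exists_coeff_eq (c : (Fin d → ℤ) → EuclideanSpace ℂ ι)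
    (hc : Summable fun k => ‖c k‖ ^ 2)
    (hh : ∀ k j, c (-k) j = (starRingEnd ℂ) (c k j)) :
    ∃ v : L2 d ι, ∀ k, coeff v k = c k := by
  have hmem : ∀ j, Memℓp (E := fun _ : Fin d → ℤ => ℂ) (fun k => c k j) 2 := by
    intro j
    refine memℓp_gen ?_
    refine Summable.of_nonneg_of_le (fun k => by positivity) (fun k => ?_) hc
    simp only [ENNReal.toReal_ofNat, Real.rpow_ofNat]
    gcongr
    exact PiLp.norm_apply_le (c k) j
  let g : ι → Lp ℂ 2 (haarT d) := fun j => (expBasis d).repr.symm ⟨_, hmem j⟩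
  have hg : ∀ j k, ∫ x, UnitAddTorus.mFourier (-k) x * g j x ∂(haarT d) = c k j := by
    intro j k
    rw [← expBasis_repr]
    simp [g]
  have hL : MemLp (fun x => (WithLp.toLp 2 fun j => (g j x).re : EuclideanSpace ℝ ι)) 2
      (haarT d) := by
    refine MemLp.of_eval_piLp fun j => ?_
    exact (Lp.memLp (g j)).re
  refine ⟨hL.toLp _, fun k => ?_⟩
  rw [coeff_congr hL.coeFn_toLp]
  ext j
  rw [coeff_apply]
  have hi : ∀ k, Integrable (fun x => UnitAddTorus.mFourier (-k) x * g j x) (haarT d) := by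
    intro k
    refine ((Lp.memLp (g j)).integrable (by norm_num)).bdd_mul (c := 1)
      (UnitAddTorus.mFourier (-k)).continuous.aestronglyMeasurable (ae_of_all _ fun x => ?_)
    exact ((UnitAddTorus.mFourier (-k)).norm_coe_le_norm x).trans UnitAddTorus.mFourier_norm.le
  -- Taking the real part replaces the `k`-th coefficient by the average of `c k` and the conjugate
  -- of `c (-k)`; by the symmetry of `c` these agree.
  have h1 : ∀ x, UnitAddTorus.mFourier (-k) x * ((((g j x).re : ℝ)) : ℂ)
      = (UnitAddTorus.mFourier (-k) x * g j x
        + (starRingEnd ℂ) (UnitAddTorus.mFourier (-(-k)) x * g j x)) / 2 := by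
    intro x
    rw [Complex.re_eq_add_conj, UnitAddTorus.mFourier_neg (n := -k), map_mul, Complex.conj_conj]
    ring
  simp only [h1]
  rw [integral_div, integral_add (hi _), integral_conj, hg, hg, hh, Complex.conj_conj]
  · ring
  · exact Complex.conjCLE.toContinuousLinearMap.integrable_comp (hi (-k))

/-! ### Synthesis -/

variable {K : ℕ}

/-- Since `Re z = (z + z̄)/2`, the mode `a` contributes half of its coefficient at `freq a` and half
of the conjugate at `-freq a`. At `freq i` only `i` and its reflection `i'` survive, and the
Hermitian symmetry makes the two halves equal. -/
theorem coeff_synthFun (c : Coeff d K ι) (hc : IsHermitian c) (i : Modes d K) :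
    coeff (synthFun c) (freq i) = c i := by
  classical
  ext j
  rw [coeff_apply]
  have hneg : ∀ l : Fin d, -(i l : ℤ) ∈ Finset.Icc (-(K : ℤ)) (K : ℤ) := by
    intro l
    have := (i l).2
    rw [Finset.mem_Icc] at this ⊢
    omega
  let i' : Modes d K := fun l => ⟨-(i l : ℤ), hneg l⟩
  have hi' : freq i' = -freq i := rfl
  have hinj : ∀ a b : Modes d K, freq a = freq b → a = b := by
    intro a b h
    funext l
    exact Subtype.ext (congrFun h l)
  have key : ∀ x : Torus d, UnitAddTorus.mFourier (-freq i) x * (((synthFun c x) j : ℝ) : ℂ)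
      = ∑ a, ((c a j / 2) * UnitAddTorus.mFourier (-freq i + freq a) x
        + ((starRingEnd ℂ) (c a j) / 2) * UnitAddTorus.mFourier (-freq i + -freq a) x) := by
    intro x
    simp only [synthFun, UnitAddTorus.mFourier_add, UnitAddTorus.mFourier_neg]
    rw [Complex.re_eq_add_conj, map_sum, ← Finset.sum_add_distrib, Finset.sum_div,
      Finset.mul_sum]
    refine Finset.sum_congr rfl fun i _ => ?_
    rw [map_mul]
    ring
  simp_rw [key]
  rw [integral_finsetSum]
  · have h3 : ∀ a : Modes d K, ∫ x, ((c a j / 2) * UnitAddTorus.mFourier (-freq i + freq a) x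
        + ((starRingEnd ℂ) (c a j) / 2) * UnitAddTorus.mFourier (-freq i + -freq a) x) ∂(haarT d)
        = (if a = i then c a j / 2 else 0)
          + (if a = i' then (starRingEnd ℂ) (c a j) / 2 else 0) := by
      intro a
      rw [integral_add ((integrable_mFourier _).const_mul _)
        ((integrable_mFourier _).const_mul _), integral_const_mul, integral_const_mul,
        integral_mFourier_eq_ite, integral_mFourier_eq_ite]
      have e1 : (-freq i + freq a = 0) ↔ a = i :=
        ⟨fun h => hinj _ _ (neg_add_eq_zero.mp h).symm, fun h => by simp [h]⟩
      have e2 : (-freq i + -freq a = 0) ↔ a = i' := by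
        constructor
        · intro h
          refine hinj _ _ ?_
          rw [hi']
          exact (neg_eq_of_add_eq_zero_left h).symm ▸ (by simp)
        · intro h
          simp [h, hi']
      simp [e1, e2]
    simp_rw [h3]
    rw [Finset.sum_add_distrib]
    simp [hc i i' hi']
  · intro a _
    exact ((integrable_mFourier _).const_mul _).add ((integrable_mFourier _).const_mul _)

theorem fwd_synth (c : Coeff d K ι) (hc : IsHermitian c) : fwd K (synth c) = c := by
  ext i : 1
  change coeff (synth c) (freq i) = c i
  rw [coeff_congr (coeFn_synth c), coeff_synthFun c hc]

theorem isHermitian_fwd (f : Torus d → EuclideanSpace ℝ ι) : IsHermitian (fwd K f) := by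
  intro i i' h j
  change coeff f (freq i') j = (starRingEnd ℂ) (coeff f (freq i) j)
  rw [h, coeff_neg_apply]

/-- Synthesis as a linear map. -/
def synthL (d K : ℕ) (ι : Type) [Fintype ι] : Coeff d K ι →ₗ[ℝ] L2 d ι where
  toFun := synth
  map_add' a b := by
    rw [synth, synth, synth, ← map_add]
    congr 1
    ext x j
    simp [synthFun, add_mul, Finset.sum_add_distrib]
  map_smul' r a := by
    rw [synth, synth, RingHom.id_apply, ← map_smul]
    congr 1
    ext x j
    simp only [synthFun, PiLp.smul_apply, ContinuousMap.coe_mk, ContinuousMap.coe_smul,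
      Pi.smul_apply, Complex.real_smul, mul_assoc, ← Finset.mul_sum, Complex.re_ofReal_mul,
      smul_eq_mul]

theorem synth_sub (a b : Coeff d K ι) : synth (a - b) = synth a - synth b :=
  map_sub (synthL d K ι) a b

omit [Fintype ι] in
theorem exists_freq_eq_or (k : Fin d → ℤ) :
    (∃ i : Modes d K, freq i = k) ∨ ∃ j, k j ∉ Finset.Icc (-(K : ℤ)) (K : ℤ) := by
  by_cases h : ∃ j, k j ∉ Finset.Icc (-(K : ℤ)) (K : ℤ)
  · exact Or.inr h
  · push Not at h
    exact Or.inl ⟨fun j => ⟨k j, h j⟩, rfl⟩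

theorem freq_injective : Function.Injective (freq : Modes d K → Fin d → ℤ) := by
  intro a b h
  funext l
  exact Subtype.ext (congrFun h l)

theorem coeff_synth_of_notMem (c : Coeff d K ι) {k : Fin d → ℤ}
    (hk : k ∉ Set.range (freq : Modes d K → Fin d → ℤ)) : coeff (synth c) k = 0 := by
  rw [coeff_congr (coeFn_synth c)]
  refine coeff_synthFun_of_notMem c ?_
  exact (exists_freq_eq_or (K := K) k).resolve_left fun ⟨i, hi⟩ => hk ⟨i, hi⟩

/-- Coefficients outside the retained cube vanish, so Parseval's series reduces to the finite sum
over modes. Without the Hermitian condition the real part would discard information and the identity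
would fail. -/
theorem norm_sq_synth (c : Coeff d K ι) (hc : IsHermitian c) :
    ‖synth c‖ ^ 2 = ∑ i, ‖c i‖ ^ 2 := by
  have h := hasSum_norm_sq_coeff (synth c)
  have h2 : HasSum ((fun k => ‖coeff (synth c) k‖ ^ 2) ∘ (freq : Modes d K → Fin d → ℤ))
      (‖synth c‖ ^ 2) :=
    (freq_injective.hasSum_iff fun k hk => by simp [coeff_synth_of_notMem c hk]).2 h
  rw [h2.unique (hasSum_fintype _)]
  refine Finset.sum_congr rfl fun i _ => ?_
  simp only [Function.comp_apply]
  rw [coeff_congr (coeFn_synth c), coeff_synthFun c hc]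

theorem norm_synth (c : Coeff d K ι) (hc : IsHermitian c) : ‖synth c‖ = ‖c‖ := by
  rw [← sq_eq_sq₀ (norm_nonneg _) (norm_nonneg _), norm_sq_synth c hc, PiLp.norm_sq_eq_of_L2]

theorem IsHermitian.sub {a b : Coeff d K ι} (ha : IsHermitian a) (hb : IsHermitian b) :
    IsHermitian (a - b) := by
  intro i i' h j
  simp [ha i i' h j, hb i i' h j]

theorem fwd_projL2 (w : L2 d ι) : fwd K (projL2 K w) = fwd K w :=
  fwd_synth _ (isHermitian_fwd _)

theorem spec_eq {s : ℝ} (v : Sob d s ι) : spec K v = fwd K v.toL2 :=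
  fwd_synth _ (isHermitian_fwd _)

theorem proj_eq {s : ℝ} (v : Sob d s ι) : proj K v = synthSob s (spec K v) := by
  rw [spec_eq]; rfl

open Classical in
theorem coeff_projL2 (w : L2 d ι) (k : Fin d → ℤ) :
    coeff (projL2 K w) k
      = if k ∈ Set.range (freq : Modes d K → Fin d → ℤ) then coeff w k else 0 := by
  split_ifs with h
  · obtain ⟨i, rfl⟩ := h
    exact congrArg (fun c : Coeff d K ι => c i) (fwd_projL2 (K := K) w)
  · exact coeff_synth_of_notMem _ h

/-- Truncated coefficients as a linear map. -/
def fwdA (d K : ℕ) (ι : Type) [Fintype ι] : L2 d ι →+ Coeff d K ι :=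
  AddMonoidHom.mk' (fun u => fwd K u) fun u v => by
    ext i : 1
    exact coeff_add u v (freq i)

theorem norm_fwd_le (u : L2 d ι) : ‖fwd K u‖ ≤ ‖u‖ := by
  refine le_of_sq_le_sq ?_ (norm_nonneg _)
  rw [PiLp.norm_sq_eq_of_L2]
  have h := hasSum_norm_sq_coeff u
  have h2 := sum_le_hasSum (Finset.univ.map ⟨(freq : Modes d K → Fin d → ℤ), freq_injective⟩)
    (fun _ _ => by positivity) h
  rw [Finset.sum_map] at h2
  exact h2

theorem continuous_fwd : Continuous fun u : L2 d ι => fwd K u :=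
  (AddMonoidHomClass.lipschitz_of_bound (fwdA d K ι) 1 fun u => by
    simpa using! norm_fwd_le u).continuous

/-! ### Sobolev spaces -/

variable {s : ℝ}

theorem one_le_sobWeight (k : Fin d → ℤ) : 1 ≤ sobWeight k := by
  unfold sobWeight
  have : 0 ≤ ∑ j, (k j : ℝ) ^ 2 := by positivity
  linarith

theorem sobWeight_pos (k : Fin d → ℤ) : 0 < sobWeight k :=
  zero_lt_one.trans_le (one_le_sobWeight k)

theorem Sob.weighted_apply (v : Sob d s ι) (k : Fin d → ℤ) :
    v.weighted k = ((sobWeight k ^ (s / 2) : ℝ) : ℂ) • coeff v.toL2 k := rfl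

theorem Sob.dist_eq (u v : Sob d s ι) : dist u v = ‖u.weighted - v.weighted‖ :=
  dist_eq_norm u.weighted v.weighted

theorem Sob.continuous_weighted : Continuous (Sob.weighted : Sob d s ι → _) :=
  continuous_induced_dom

theorem Sob.ext_coeff {u v : Sob d s ι} (h : ∀ k, coeff u.toL2 k = coeff v.toL2 k) : u = v := by
  have := L2.ext_coeff h
  cases u; cases v
  simpa using this

theorem Sob.coeff_eq (v : Sob d s ι) (k : Fin d → ℤ) :
    coeff v.toL2 k = ((sobWeight k ^ (-(s / 2)) : ℝ) : ℂ) • v.weighted k := by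
  rw [Sob.weighted_apply, smul_smul, ← Complex.ofReal_mul, ← Real.rpow_add (sobWeight_pos k)]
  simp

theorem Sob.continuous_coeff (k : Fin d → ℤ) :
    Continuous fun v : Sob d s ι => coeff v.toL2 k := by
  simp_rw [Sob.coeff_eq]
  refine Continuous.const_smul (M := ℂ) ?_ _
  exact ((lp.evalCLM ℂ (fun _ : Fin d → ℤ => EuclideanSpace ℂ ι) 2 k).continuous.comp
    Sob.continuous_weighted)

theorem continuous_spec : Continuous (spec K : Sob d s ι → Coeff d K ι) := by
  have : (spec K : Sob d s ι → Coeff d K ι)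
      = fun v => WithLp.toLp 2 fun i => coeff v.toL2 (freq i) := by
    funext v
    exact spec_eq v
  rw [this]
  refine (PiLp.continuous_toLp 2 _).comp (continuous_pi fun i => ?_)
  exact Sob.continuous_coeff (freq i)

/-- The coefficient space is finite-dimensional, so real linearity into the weighted sequence space
suffices and no norm estimate is needed. -/
theorem continuous_synthSob : Continuous (synthSob s : Coeff d K ι → Sob d s ι) := by
  refine continuous_induced_rng.2 ?_
  let L : Coeff d K ι →ₗ[ℝ] lp (fun _ : Fin d → ℤ => EuclideanSpace ℂ ι) 2 :=
    { toFun := fun c => (synthSob s c).weighted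
      map_add' := fun a b => by
        ext k : 2
        have := coeff_add (synth a) (synth b) k
        rw [← (show synth (a + b) = synth a + synth b from map_add (synthL d K ι) a b)] at this
        simp only [lp.coeFn_add, Pi.add_apply, Sob.weighted_apply, synthSob, this, smul_add]
      map_smul' := fun r a => by
        ext k j
        have h1 : synth (r • a) = r • synth a := map_smul (synthL d K ι) r a
        simp only [lp.coeFn_smul, Pi.smul_apply, Sob.weighted_apply, synthSob, h1,
          RingHom.id_apply, PiLp.smul_apply, coeff_eq_repr, map_smul]
        rw [expBasis_repr, expBasis_repr]
        have : ∫ x, UnitAddTorus.mFourier (-k) x * (r • channel j (synth a)) x ∂(haarT d)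
            = ∫ x, (r : ℂ) * (UnitAddTorus.mFourier (-k) x * (channel j (synth a)) x)
              ∂(haarT d) := by
          refine integral_congr_ae ?_
          filter_upwards [Lp.coeFn_smul r (channel j (synth a))] with x hx
          rw [hx, Pi.smul_apply, Complex.real_smul]
          ring
        rw [this, integral_const_mul]
        simp only [smul_eq_mul, Complex.real_smul]
        ring }
  exact LinearMap.continuous_of_finiteDimensional L

open Classical in
theorem weighted_proj (v : Sob d s ι) (k : Fin d → ℤ) :
    (proj K v).weighted k
      = if k ∈ Set.range (freq : Modes d K → Fin d → ℤ) then v.weighted k else 0 := by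
  rw [Sob.weighted_apply, show (proj K v).toL2 = projL2 K v.toL2 from rfl, coeff_projL2]
  split_ifs <;> simp [Sob.weighted_apply]

/-- The projection deletes entries of the weighted sequence, whatever the Sobolev order. -/
theorem dist_proj_le (u v : Sob d s ι) : dist (proj K u) (proj K v) ≤ dist u v := by
  rw [Sob.dist_eq, Sob.dist_eq]
  refine lp.norm_mono (by norm_num) fun k => ?_
  simp only [lp.coeFn_sub, Pi.sub_apply, weighted_proj]
  split_ifs <;> simp

/-- An `ℓ²` sequence is the unconditional sum of its entries, and the frequency cubes are cofinal
among the finite sets of frequencies. -/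
theorem tendsto_proj (v : Sob d s ι) : Tendsto (fun K => proj K v) atTop (𝓝 v) := by
  classical
  rw [tendsto_iff_dist_tendsto_zero]
  have h := lp.hasSum_single (p := 2) (by norm_num) v.weighted
  let S : ℕ → Finset (Fin d → ℤ) := fun K =>
    Finset.univ.image (freq : Modes d K → Fin d → ℤ)
  have hS : Tendsto S atTop atTop := by
    refine tendsto_atTop_finset_of_monotone ?_ ?_
    · intro K K' hK k hk
      simp only [S, Finset.mem_image, Finset.mem_univ, true_and] at hk ⊢
      obtain ⟨i, rfl⟩ := hk
      refine ⟨fun l => ⟨i l, ?_⟩, rfl⟩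
      have := (i l).2
      rw [Finset.mem_Icc] at this ⊢
      omega
    · intro k
      -- The sum of the absolute values bounds every entry, and is also meaningful for `d = 0`.
      refine ⟨∑ j, (k j).natAbs, ?_⟩
      simp only [S, Finset.mem_image, Finset.mem_univ, true_and]
      refine ⟨fun l => ⟨k l, ?_⟩, rfl⟩
      have := Finset.single_le_sum (f := fun j => (k j).natAbs) (fun _ _ => Nat.zero_le _)
        (Finset.mem_univ l)
      rw [Finset.mem_Icc]
      omega
  have h2 := h.comp hS
  have h3 := tendsto_iff_dist_tendsto_zero.1 h2
  refine h3.congr fun K => ?_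
  rw [Sob.dist_eq, dist_eq_norm]
  congr 1
  congr 1
  ext k : 2
  simp only [Function.comp_apply, lp.coeFn_sum, Finset.sum_apply, weighted_proj, S,
    lp.single_apply, Pi.single_apply]
  simp

/-- A square-integrable function as an element of the Sobolev space of order `0`. -/
def L2.toSob (w : L2 d ι) : Sob d 0 ι :=
  ⟨w, memℓp_gen (by simpa using (hasSum_norm_sq_coeff w).summable)⟩

/-- At order `0` all weights are `1`. Contractivity and strong convergence of the projections on
`L²` thereby follow from the Sobolev case. -/
theorem L2.dist_eq (u v : L2 d ι) : dist u v = dist (L2.toSob u) (L2.toSob v) := by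
  have h := lp.hasSum_norm (p := 2) (by norm_num) ((L2.toSob u).weighted - (L2.toSob v).weighted)
  have h2 := hasSum_norm_sq_coeff (u - v)
  simp only [coeff_sub] at h2
  rw [Sob.dist_eq, dist_eq_norm, ← sq_eq_sq₀ (norm_nonneg _) (norm_nonneg _)]
  refine h2.unique ?_
  simpa [Sob.weighted_apply, L2.toSob] using h

theorem tendsto_projL2 (w : L2 d ι) : Tendsto (fun K => projL2 K w) atTop (𝓝 w) := by
  rw [tendsto_iff_dist_tendsto_zero]
  simp_rw [L2.dist_eq]
  exact tendsto_iff_dist_tendsto_zero.1 (tendsto_proj (L2.toSob w))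

theorem dist_projL2_le (u v : L2 d ι) : dist (projL2 K u) (projL2 K v) ≤ dist u v := by
  simp_rw [L2.dist_eq]
  exact dist_proj_le (L2.toSob u) (L2.toSob v)

/-- The projections are uniformly Lipschitz, so pointwise convergence is locally uniform, and
compactness makes it uniform on `V`. -/
theorem tendstoUniformlyOn_projL2_proj {V : Set (Sob d s ι)} (hV : IsCompact V)
    {M : Sob d s ι → L2 d ι} (hM : Continuous M) :
    TendstoUniformlyOn (fun K v => projL2 K (M (proj K v))) M atTop V := by
  rw [← tendstoLocallyUniformlyOn_iff_tendstoUniformlyOn_of_compact hV,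
    Metric.tendstoLocallyUniformlyOn_iff]
  intro ε hε v _
  obtain ⟨δ, hδ, hMδ⟩ := Metric.continuous_iff.1 hM v (ε / 3) (by positivity)
  -- One half of `δ` is for moving from `u` to `v`, the other for the truncation error at the centre
  -- `v`.
  refine ⟨Metric.ball v (δ / 2), mem_nhdsWithin_of_mem_nhds (Metric.ball_mem_nhds _ (by positivity)),
    ?_⟩
  have h1 := Metric.tendsto_nhds.1 (tendsto_proj v) (δ / 2) (by positivity)
  have h2 := Metric.tendsto_nhds.1 (tendsto_projL2 (M v)) (ε / 3) (by positivity)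
  filter_upwards [h1, h2] with K h1 h2 u hu
  rw [Metric.mem_ball] at hu
  have h3 : dist (M u) (M v) < ε / 3 := hMδ u (by linarith)
  have h4 : dist (M (proj K u)) (M v) < ε / 3 := by
    refine hMδ _ ?_
    have := dist_triangle (proj K u) (proj K v) v
    have := dist_proj_le (K := K) u v
    linarith
  have h5 := dist_projL2_le (K := K) (M (proj K u)) (M v)
  have h6 := dist_triangle4 (M u) (M v) (projL2 K (M v)) (projL2 K (M (proj K u)))
  rw [dist_comm (M v) (projL2 K (M v)), dist_comm (projL2 K (M v))
    (projL2 K (M (proj K u)))] at h6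
  linarith

end

section

/-! ### Non-polynomial functions and their mollifications -/

/-- Induction on the order: the derivative is a polynomial, and `f` differs from its explicit
antiderivative `g` by the constant `f 0`. -/
theorem exists_eq_sum_pow_of_iteratedDeriv_eq_zero (k : ℕ) :
    ∀ f : ℝ → ℝ, ContDiff ℝ (⊤ : ℕ∞) f → (∀ x, iteratedDeriv k f x = 0) →
      ∃ c : ℕ → ℝ, ∀ x, f x = ∑ i ∈ Finset.range k, c i * x ^ i := by
  induction k with
  | zero => exact fun f _ h => ⟨0, fun x => by simpa using h x⟩
  | succ k ih =>
    intro f hf h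
    have hf' : ContDiff ℝ (⊤ : ℕ∞) (deriv f) := by
      refine (contDiff_succ_iff_deriv (n := ((⊤ : ℕ∞) : WithTop ℕ∞)).1 ?_).2.2
      exact hf
    obtain ⟨c, hc⟩ := ih (deriv f) hf' fun x => by rw [← iteratedDeriv_succ']; exact h x
    refine ⟨fun i => if i = 0 then f 0 else c (i - 1) / i, fun x => ?_⟩
    let g : ℝ → ℝ := fun x => ∑ i ∈ Finset.range k, c i / (i + 1 : ℝ) * x ^ (i + 1)
    have hg : ∀ x, HasDerivAt g (∑ i ∈ Finset.range k, c i * x ^ i) x := by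
      intro x
      refine HasDerivAt.fun_sum fun i _ => ?_
      convert! (hasDerivAt_pow (i + 1) x).const_mul (c i / (i + 1 : ℝ)) using 1
      have : (i + 1 : ℝ) ≠ 0 := by positivity
      push_cast
      field_simp
    have hfd : Differentiable ℝ f := hf.differentiable (by simp)
    have hd : ∀ x, HasDerivAt (fun x => f x - g x) 0 x := by
      intro x
      have h1 := (hfd x).hasDerivAt.sub (hg x)
      rw [hc, sub_self] at h1
      exact h1
    have hconst := is_const_of_deriv_eq_zero (fun x => (hd x).differentiableAt)
      (fun x => (hd x).deriv) x 0
    have hg0 : g 0 = 0 := by simp [g]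
    rw [hg0, sub_zero, sub_eq_iff_eq_add] at hconst
    rw [hconst, Finset.sum_range_succ']
    simp [g]
    ring

/-- A pointwise limit of polynomials of bounded degree is a polynomial. -/
theorem exists_polynomial_of_tendsto {f : ℝ → ℝ} {F : ℕ → ℝ → ℝ} (k : ℕ)
    (hF : ∀ x, Tendsto (fun n => F n x) atTop (𝓝 (f x)))
    (hp : ∀ n, ∃ c : ℕ → ℝ, ∀ x, F n x = ∑ i ∈ Finset.range k, c i * x ^ i) :
    ∃ q : Polynomial ℝ, ∀ x, f x = q.eval x := by
  have hinj : Set.InjOn (fun i : ℕ => (i : ℝ)) (Finset.range k : Finset ℕ) :=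
    fun a _ b _ h => Nat.cast_injective h
  -- Lagrange interpolation at `0, …, k - 1` writes each `F n` through its values at fixed nodes,
  -- with basis polynomials independent of `n`. So convergence at the nodes determines a polynomial
  -- limit.
  have h1 : ∀ n x, F n x = ∑ i ∈ Finset.range k,
      F n i * (Lagrange.basis (Finset.range k) (fun i : ℕ => (i : ℝ)) i).eval x := by
    intro n x
    obtain ⟨c, hc⟩ := hp n
    let P : Polynomial ℝ := ∑ i ∈ Finset.range k, Polynomial.C (c i) * Polynomial.X ^ i
    have hP : ∀ x, F n x = P.eval x := by
      intro x
      rw [hc]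
      simp [P, Polynomial.eval_finsetSum]
    have hdeg : P.degree < (Finset.range k).card := by
      rw [Finset.card_range]
      refine (Polynomial.degree_sum_le _ _).trans_lt ?_
      rw [Finset.sup_lt_iff (by exact WithBot.bot_lt_coe k)]
      intro i hi
      refine (Polynomial.degree_C_mul_X_pow_le i (c i)).trans_lt ?_
      exact_mod_cast Finset.mem_range.1 hi
    have := Lagrange.eq_interpolate hinj hdeg
    rw [hP, this, Lagrange.interpolate_apply, Polynomial.eval_finsetSum]
    refine Finset.sum_congr rfl fun i _ => ?_
    rw [Polynomial.eval_mul, Polynomial.eval_C, ← hP]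
  refine ⟨∑ i ∈ Finset.range k, Polynomial.C (f i)
    * Lagrange.basis (Finset.range k) (fun i : ℕ => (i : ℝ)) i, fun x => ?_⟩
  refine tendsto_nhds_unique (hF x) ?_
  simp_rw [h1 _ x, Polynomial.eval_finsetSum, Polynomial.eval_mul, Polynomial.eval_C]
  exact tendsto_finsetSum _ fun i _ => (hF i).mul_const _

/-- A continuous function that is not a polynomial has mollifications with non-vanishing
derivatives of any order. -/
theorem exists_mollification_iteratedDeriv_ne_zero {σ : ℝ → ℝ} (hc : Continuous σ)
    (hσ : ¬ ∃ q : Polynomial ℝ, ∀ x, σ x = q.eval x) (k : ℕ) :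
    ∃ φ : ℝ → ℝ, Continuous φ ∧ HasCompactSupport φ ∧
      ContDiff ℝ (⊤ : ℕ∞) (fun y => ∫ t, φ t * σ (y - t)) ∧
      ∃ b, iteratedDeriv k (fun y => ∫ t, φ t * σ (y - t)) b ≠ 0 := by
  -- Bumps supported in balls of radius `1 / (n + 1)`: their convolutions with `σ` converge to `σ`
  -- pointwise.
  let φ : ℕ → ContDiffBump (0 : ℝ) := fun n =>
    ⟨1 / ((n : ℝ) + 1) / 2, 1 / ((n : ℝ) + 1), by positivity, half_lt_self (by positivity)⟩
  have hφ : Tendsto (fun n => (φ n).rOut) atTop (𝓝 0) := tendsto_one_div_add_atTop_nhds_zero_nat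
  have hsm : ∀ n, ContDiff ℝ (⊤ : ℕ∞) (fun y => ∫ t, (φ n).normed volume t * σ (y - t)) :=
    fun n => (φ n).hasCompactSupport_normed.contDiff_convolution_left
      (ContinuousLinearMap.lsmul ℝ ℝ) (φ n).contDiff_normed (hc.locallyIntegrable (μ := volume))
  by_contra hcon
  push Not at hcon
  refine hσ (exists_polynomial_of_tendsto k
    (F := fun n y => ∫ t, (φ n).normed volume t * σ (y - t)) (fun x => ?_) fun n => ?_)
  · exact ContDiffBump.convolution_tendsto_right_of_continuous (μ := volume) hφ hc x
  · exact exists_eq_sum_pow_of_iteratedDeriv_eq_zero k _ (hsm n)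
      (hcon _ (φ n).continuous_normed (φ n).hasCompactSupport_normed (hsm n))

/-! ### Closed subspaces of continuous functions -/

variable {X : Type*} [TopologicalSpace X] [CompactSpace X]

/-- The quotient by a closed subspace is a normed space whose projection is continuous, so it
commutes with the integral, and it kills every value of `F`. -/
theorem Submodule.integral_mem {E α : Type*} [NormedAddCommGroup E] [NormedSpace ℝ E]
    [CompleteSpace E] [MeasurableSpace α] {μ : Measure α} {S : Submodule ℝ E}
    (hS : IsClosed (S : Set E)) {F : α → E} (hF : Integrable F μ) (h : ∀ t, F t ∈ S) :
    ∫ t, F t ∂μ ∈ S := by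
  have h0 := (S.mkQL).integral_comp_comm hF
  have : IsClosed (S : Set E) := hS
  have h1 : ∀ t, S.mkQL (F t) = 0 := fun t => (Submodule.Quotient.mk_eq_zero S).2 (h t)
  simp only [h1, integral_zero] at h0
  exact (Submodule.Quotient.mk_eq_zero S).1 h0.symm

/-- The function `x ↦ f (a ℓ(x) + b)`. -/
def ridge (f : C(ℝ, ℝ)) (ℓ : C(X, ℝ)) (a b : ℝ) : C(X, ℝ) :=
  ⟨fun x => f (a * ℓ x + b), by fun_prop⟩

/-- Convolution acts on the bias alone: a mollified ridge function is a vector-valued integral of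
ridge functions of `σ` with biases `b - t`. -/
theorem ridge_mollification_mem {S : Submodule ℝ C(X, ℝ)} (hS : IsClosed (S : Set C(X, ℝ)))
    {σ g : C(ℝ, ℝ)} {φ : ℝ → ℝ} (hφ : Continuous φ) (hφc : HasCompactSupport φ)
    (hg : ∀ y, g y = ∫ t, φ t * σ (y - t)) {ℓ : C(X, ℝ)} {a : ℝ}
    (h : ∀ b, ridge σ ℓ a b ∈ S) (b : ℝ) : ridge g ℓ a b ∈ S := by
  let F : ℝ → C(X, ℝ) := fun t => φ t • ridge σ ℓ a (b - t)
  have hFc : Continuous F := by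
    refine hφ.smul ?_
    have : Continuous (fun p : ℝ × X => σ (a * ℓ p.2 + (b - p.1))) := by fun_prop
    -- Joint continuity in the parameter and the point, with `X` compact, is continuity of the curve
    -- for the uniform norm.
    exact (ContinuousMap.curry ⟨_, this⟩).continuous
  have hFi : Integrable F := hFc.integrable_of_hasCompactSupport hφc.smul_right
  have := Submodule.integral_mem hS hFi fun t => S.smul_mem _ (h _)
  convert this using 1
  ext x
  rw [ContinuousMap.integral_apply hFi]
  simp only [ridge, ContinuousMap.coe_mk, F, ContinuousMap.smul_apply, smul_eq_mul, hg]
  congr 1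
  funext t
  congr 2
  ring

theorem deriv_mem {E : Type*} [NormedAddCommGroup E] [NormedSpace ℝ E] {S : Submodule ℝ E}
    (hS : IsClosed (S : Set E)) {G : ℝ → E} {G' : E} {a : ℝ} (hG : HasDerivAt G G' a)
    (h : ∀ t, G t ∈ S) : G' ∈ S :=
  hS.mem_of_tendsto (hasDerivAt_iff_tendsto_slope.1 hG) <| Eventually.of_forall fun t =>
    S.smul_mem _ (S.sub_mem (h t) (h a))

/-- Each derivative in the inner weight `a` brings down a factor `ℓ`, and difference quotients of
curves in `S` stay in the closed subspace `S`. -/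
theorem pow_mul_iteratedDeriv_mem {S : Submodule ℝ C(X, ℝ)} (hS : IsClosed (S : Set C(X, ℝ)))
    {f : C(ℝ, ℝ)} (hf : ContDiff ℝ (⊤ : ℕ∞) f) {ℓ : C(X, ℝ)} {b : ℝ}
    (h : ∀ a, ridge f ℓ a b ∈ S) (k : ℕ) :
    ∀ a, ∀ g : C(X, ℝ), (∀ x, g x = ℓ x ^ k * iteratedDeriv k f (a * ℓ x + b)) → g ∈ S := by
  have hcd : ∀ k, Continuous (iteratedDeriv k f) := fun k =>
    hf.continuous_iteratedDeriv k (by exact_mod_cast le_top)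
  let G : ℕ → ℝ → C(X, ℝ) := fun k a =>
    ⟨fun x => ℓ x ^ k * iteratedDeriv k f (a * ℓ x + b),
      (ℓ.continuous.pow k).mul ((hcd k).comp (by fun_prop))⟩
  have hGc : ∀ k, Continuous (G k) := by
    intro k
    have : Continuous (fun p : ℝ × X => ℓ p.2 ^ k * iteratedDeriv k f (p.1 * ℓ p.2 + b)) :=
      Continuous.mul (by fun_prop) ((hcd k).comp (by fun_prop))
    exact (ContinuousMap.curry ⟨_, this⟩).continuous
  have hpt : ∀ k a x, HasDerivAt (fun t => G k t x) (G (k + 1) a x) a := by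
    intro k a x
    have h1 : HasDerivAt (iteratedDeriv k f) (iteratedDeriv (k + 1) f (a * ℓ x + b))
        (a * ℓ x + b) := by
      rw [iteratedDeriv_succ]
      exact ((hf.differentiable_iteratedDeriv k (by exact_mod_cast WithTop.coe_lt_top k))
        _).hasDerivAt
    have h2 : HasDerivAt (fun t : ℝ => t * ℓ x + b) (ℓ x) a := by
      simpa using ((hasDerivAt_id a).mul_const (ℓ x)).add_const b
    convert! (h1.comp a h2).const_mul (ℓ x ^ k) using 1
    simp only [G, ContinuousMap.coe_mk]
    ring
  have hder : ∀ k a, HasDerivAt (G k) (G (k + 1) a) a := by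
    intro k a
    -- Pointwise derivatives become derivatives in the uniform norm: evaluation at points shows that
    -- `G k` is an integral of the continuous curve `G (k + 1)`.
    have h1 : ∀ t, G k t = G k 0 + ∫ u in (0 : ℝ)..t, G (k + 1) u := by
      intro t
      ext x
      have h2 := (ContinuousMap.evalCLM ℝ x).intervalIntegral_comp_comm
        ((hGc (k + 1)).intervalIntegrable (μ := volume) 0 t)
      have h3 := intervalIntegral.integral_eq_sub_of_hasDerivAt (a := 0) (b := t)
        (fun u _ => hpt k u x)
        (((ContinuousMap.evalCLM ℝ x).continuous.comp (hGc (k + 1))).intervalIntegrable 0 t)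
      have h4 : (∫ u in (0 : ℝ)..t, G (k + 1) u) x = ∫ u in (0 : ℝ)..t, G (k + 1) u x := h2.symm
      rw [ContinuousMap.add_apply, h4, h3]
      ring
    have h5 := intervalIntegral.integral_hasDerivAt_right
      ((hGc (k + 1)).intervalIntegrable (μ := volume) 0 a)
      ((hGc (k + 1)).stronglyMeasurableAtFilter _ _) (hGc (k + 1)).continuousAt
    exact (h5.const_add (G k 0)).congr_of_eventuallyEq (Eventually.of_forall h1)
  have key : ∀ k a, G k a ∈ S := by
    intro k
    induction k with
    | zero =>
      intro a
      convert h a using 1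
      ext x
      simp [G, ridge]
    | succ k ih => exact fun a => deriv_mem hS (hder k a) ih
  intro a g hg
  convert key k a using 1
  ext x
  exact hg x

/-- At `a = 0` the `k`-th derivative no longer depends on the point: it is `ℓ ^ k` times a constant,
which is nonzero for a suitable mollification and bias. -/
theorem pow_mem_of_ridge_mem {S : Submodule ℝ C(X, ℝ)} (hS : IsClosed (S : Set C(X, ℝ)))
    {σ : C(ℝ, ℝ)} (hσ : ¬ ∃ q : Polynomial ℝ, ∀ x, σ x = q.eval x) {ℓ : C(X, ℝ)}
    (h : ∀ a b, ridge σ ℓ a b ∈ S) (k : ℕ) : ℓ ^ k ∈ S := by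
  obtain ⟨φ, hφ, hφc, hsm, b, hb⟩ :=
    exists_mollification_iteratedDeriv_ne_zero σ.continuous hσ k
  let g : C(ℝ, ℝ) := ⟨fun y => ∫ t, φ t * σ (y - t), hsm.continuous⟩
  have h1 : ∀ a, ridge g ℓ a b ∈ S := fun a =>
    ridge_mollification_mem hS hφ hφc (fun _ => rfl) (h a) b
  have h2 := pow_mul_iteratedDeriv_mem hS (f := g) hsm h1 k 0 (iteratedDeriv k g b • ℓ ^ k)
    fun x => by simp [mul_comm]
  exact (S.smul_mem_iff hb).1 h2

theorem exp_mem_of_pow_mem {S : Submodule ℝ C(X, ℝ)} (hS : IsClosed (S : Set C(X, ℝ)))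
    {ℓ : C(X, ℝ)} (h : ∀ k, ℓ ^ k ∈ S) : NormedSpace.exp ℓ ∈ S :=
  hS.mem_of_tendsto (NormedSpace.exp_series_hasSum_exp' (𝕂 := ℝ) ℓ) <|
    Eventually.of_forall fun _ => S.sum_mem fun k _ => S.smul_mem _ (h k)

theorem exp_apply (ℓ : C(X, ℝ)) (x : X) : NormedSpace.exp ℓ x = Real.exp (ℓ x) := by
  rw [Real.exp_eq_exp_ℝ]
  exact NormedSpace.map_exp (ContinuousMap.evalAlgHom ℝ ℝ x) (continuous_eval_const x) ℓ

/-- Ridge functions of a non-polynomial activation along a point-separating cone of directions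
span a dense subspace. -/
theorem eq_top_of_ridge_mem {S : Submodule ℝ C(X, ℝ)} (hS : IsClosed (S : Set C(X, ℝ)))
    {σ : C(ℝ, ℝ)} (hσ : ¬ ∃ q : Polynomial ℝ, ∀ x, σ x = q.eval x) (Λ : AddSubmonoid C(X, ℝ))
    (hΛ : ∀ x y : X, x ≠ y → ∃ ℓ ∈ Λ, ℓ x ≠ ℓ y)
    (h : ∀ ℓ ∈ Λ, ∀ a b, ridge σ ℓ a b ∈ S) : S = ⊤ := by
  have hexp : ∀ ℓ ∈ Λ, NormedSpace.exp ℓ ∈ S := fun ℓ hℓ =>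
    exp_mem_of_pow_mem hS (pow_mem_of_ridge_mem hS hσ (h ℓ hℓ))
  -- Since `exp a * exp b = exp (a + b)`, the exponentials already form a submonoid, so the algebra
  -- they generate is just their linear span and stays inside `S`.
  let P : Submonoid C(X, ℝ) :=
    { carrier := NormedSpace.exp '' (Λ : Set C(X, ℝ))
      one_mem' := ⟨0, Λ.zero_mem, NormedSpace.exp_zero⟩
      mul_mem' := by
        rintro _ _ ⟨a, ha, rfl⟩ ⟨b, hb, rfl⟩
        exact ⟨a + b, Λ.add_mem ha hb, NormedSpace.exp_add⟩ }
  have hPS : (P : Set C(X, ℝ)) ⊆ S := by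
    rintro _ ⟨a, ha, rfl⟩
    exact hexp a ha
  let A : Subalgebra ℝ C(X, ℝ) := Algebra.adjoin ℝ (P : Set C(X, ℝ))
  have hA : Subalgebra.toSubmodule A ≤ S := by
    rw [Algebra.adjoin_eq_span, Submonoid.closure_eq]
    exact Submodule.span_le.2 hPS
  have hsep : A.SeparatesPoints := by
    intro x y hxy
    obtain ⟨ℓ, hℓ, hne⟩ := hΛ x y hxy
    refine ⟨_, ⟨NormedSpace.exp ℓ, Algebra.subset_adjoin ⟨ℓ, hℓ, rfl⟩, rfl⟩, ?_⟩
    simp only [exp_apply]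
    exact fun he => hne (Real.exp_injective he)
  refine eq_top_iff.2 fun f _ => ?_
  have hf := ContinuousMap.continuousMap_mem_subalgebra_closure_of_separatesPoints A hsep f
  exact closure_minimal (show (A : Set C(X, ℝ)) ⊆ S from hA) hS hf

/-! ### Universal approximation -/

variable {ι κ : Type} [Fintype ι] [Fintype κ]

theorem piLp_norm_le_card_mul {κ : Type*} [Fintype κ] {E : κ → Type*}
    [∀ i, NormedAddCommGroup (E i)] (y : PiLp 2 E) {δ : ℝ} (h : ∀ j, ‖y j‖ ≤ δ) :
    ‖y‖ ≤ Fintype.card κ * δ := by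
  have hsum : ‖y‖ ≤ ∑ j, ‖y j‖ := by
    rw [PiLp.norm_eq_of_L2]
    refine Real.sqrt_le_iff.2 ⟨by positivity, ?_⟩
    exact Finset.sum_sq_le_sq_sum_of_nonneg fun _ _ => norm_nonneg _
  refine hsum.trans ((Finset.sum_le_card_nsmul _ _ δ fun j _ => h j).trans ?_)
  rw [nsmul_eq_mul, Finset.card_univ]

theorem norm_le_card_mul (y : EuclideanSpace ℝ κ) {δ : ℝ} (h : ∀ j, |y j| ≤ δ) :
    ‖y‖ ≤ Fintype.card κ * δ :=
  piLp_norm_le_card_mul y h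

omit [Fintype κ] in
/-- A finite family of hidden units is a network. -/
theorem NN.exists_eval_eq (σ : ℝ → ℝ) {H : Type} [Fintype H] (A : Matrix H ι ℝ) (b : H → ℝ)
    (C : Matrix κ H ℝ) : ∃ Φ : NN ι κ, ∀ y,
      Φ.eval σ y = WithLp.toLp 2 (C.mulVec fun h => σ (A.mulVec (WithLp.ofLp y) h + b h)) := by
  -- A network has `width + 1` units, so a dummy unit `none` with zero weights is added; this also
  -- allows `H` to be empty.
  let e : Option H ≃ ZMod (Fintype.card H + 1) :=
    (Fintype.equivFinOfCardEq (by simp)).trans (ZMod.finEquiv _).toEquiv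
  refine ⟨⟨Fintype.card H, fun h i => (e.symm h).elim 0 fun h => A h i,
    fun h => (e.symm h).elim 0 b, fun j h => (e.symm h).elim 0 fun h => C j h⟩, fun y => ?_⟩
  ext j
  simp only [NN.eval, Matrix.mulVec, dotProduct]
  rw [← e.sum_comp, Fintype.sum_option]
  simp

/-- Density of one-hidden-layer networks with a non-polynomial activation. -/
theorem NN.exists_eval_approx {σ : ℝ → ℝ} (hc : Continuous σ)
    (hσ : ¬ ∃ q : Polynomial ℝ, ∀ x, σ x = q.eval x) {X : Set (EuclideanSpace ℝ ι)}
    (hX : IsCompact X) {f : EuclideanSpace ℝ ι → EuclideanSpace ℝ κ} (hf : ContinuousOn f X)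
    {ε : ℝ} (hε : 0 < ε) : ∃ Φ : NN ι κ, ∀ y ∈ X, ‖Φ.eval σ y - f y‖ ≤ ε := by
  classical
  have : CompactSpace X := isCompact_iff_compactSpace.1 hX
  let lf : (ι → ℝ) → C(X, ℝ) := fun a => ⟨fun x => ∑ i, a i * x.1 i, by fun_prop⟩
  let u : (ι → ℝ) × ℝ → C(X, ℝ) := fun p => ridge ⟨σ, hc⟩ (lf p.1) 1 p.2
  let Λ : AddSubmonoid C(X, ℝ) :=
    { carrier := Set.range lf
      zero_mem' := ⟨0, by ext; simp [lf]⟩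
      add_mem' := by
        rintro _ _ ⟨a, rfl⟩ ⟨b, rfl⟩
        exact ⟨a + b, by ext; simp [lf, add_mul, Finset.sum_add_distrib]⟩ }
  have hΛ : ∀ x y : X, x ≠ y → ∃ ℓ ∈ Λ, ℓ x ≠ ℓ y := by
    intro x y hxy
    by_contra hcon
    push Not at hcon
    refine hxy (Subtype.ext ?_)
    ext i
    simpa [lf, Pi.single_apply] using hcon (lf (Pi.single i 1)) ⟨_, rfl⟩
  have htop : (Submodule.span ℝ (Set.range u)).topologicalClosure = ⊤ := by
    refine eq_top_of_ridge_mem (Submodule.isClosed_topologicalClosure _) (σ := ⟨σ, hc⟩) hσ Λ hΛ ?_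
    rintro _ ⟨w, rfl⟩ a b
    refine Submodule.le_topologicalClosure _ (Submodule.subset_span ⟨(a • w, b), ?_⟩)
    ext x
    simp [u, ridge, lf, Finset.mul_sum, mul_assoc]
  -- Tolerance for one output coordinate; the `+ 1` avoids division by zero when there are no
  -- outputs.
  let δ : ℝ := ε / (Fintype.card κ + 1)
  have hδ : 0 < δ := by positivity
  have happ : ∀ j, ∃ c : (ι → ℝ) × ℝ →₀ ℝ, ∀ x : X,
      |(c.sum fun p a => a • u p) x - f x j| ≤ δ := by
    intro j
    let F : C(X, ℝ) := ⟨fun x => f x j, by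
      have h1 : Continuous fun x : X => f x := hf.domRestrict
      exact (EuclideanSpace.proj j : EuclideanSpace ℝ κ →L[ℝ] ℝ).continuous.comp h1⟩
    have hF : F ∈ closure (Submodule.span ℝ (Set.range u) : Set C(X, ℝ)) := by
      rw [← Submodule.topologicalClosure_coe, htop]
      trivial
    obtain ⟨g, hg, hd⟩ := Metric.mem_closure_iff.1 hF δ hδ
    obtain ⟨c, rfl⟩ := Finsupp.mem_span_range_iff_exists_finsupp.1 hg
    refine ⟨c, fun x => ?_⟩
    have := (ContinuousMap.dist_apply_le_dist x).trans hd.le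
    rwa [dist_comm, Real.dist_eq] at this
  choose c hcδ using happ
  -- Each output coordinate gets its own block of hidden units, and the output matrix reads only the
  -- block of its coordinate.
  obtain ⟨Φ, hΦ⟩ := NN.exists_eval_eq σ (H := Σ j : κ, (c j).support)
    (fun h i => h.2.1.1 i) (fun h => h.2.1.2)
    (fun j h => if h.1 = j then c j h.2.1 else 0)
  refine ⟨Φ, fun y hy => ?_⟩
  have hcomp : ∀ j, |(Φ.eval σ y - f y) j| ≤ δ := by
    intro j
    refine le_of_eq_of_le ?_ (hcδ j ⟨y, hy⟩)
    rw [PiLp.sub_apply, hΦ]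
    congr 2
    simp only [Matrix.mulVec, dotProduct, ite_mul, zero_mul]
    rw [Fintype.sum_sigma, Finset.sum_eq_single j]
    · simp only [if_true]
      rw [Finsupp.sum, ContinuousMap.sum_apply,
        ← Finset.sum_coe_sort (c j).support fun p => (c j p • u p) ⟨y, hy⟩]
      simp [u, ridge, lf]
    · intro j' _ hj'
      simp [hj']
    · simp
  refine (norm_le_card_mul _ hcomp).trans ?_
  simp only [δ]
  rw [mul_div_assoc', div_le_iff₀ (by positivity)]
  nlinarith

omit [Fintype κ] in
theorem NN.continuous_eval {σ : ℝ → ℝ} (hc : Continuous σ) (Φ : NN ι κ) :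
    Continuous (Φ.eval σ) := by
  refine (PiLp.continuous_toLp 2 _).comp ?_
  refine Continuous.matrix_mulVec continuous_const (continuous_pi fun h => hc.comp ?_)
  refine Continuous.add ?_ continuous_const
  exact (continuous_apply h).comp
    (Continuous.matrix_mulVec continuous_const (PiLp.continuous_ofLp 2 _))

end

section

variable {d K : ℕ} {ι κ μ : Type}

/-! ### Real encodings of complex vectors -/

section Encoding

/-- The inverse of `enc`. -/
def dec (ι : Type) [Fintype ι] (y : EuclideanSpace ℝ ((Modes d K × ι) × Bool)) : Coeff d K ι :=
  WithLp.toLp 2 fun i => WithLp.toLp 2 fun l => ⟨y ((i, l), false), y ((i, l), true)⟩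

variable [Fintype ι] [Fintype κ]

theorem dec_enc (c : Coeff d K ι) : dec ι (enc c) = c := by
  ext i l
  simp [dec, enc, realify]

theorem enc_dec (y : EuclideanSpace ℝ ((Modes d K × ι) × Bool)) : enc (dec ι y) = y := by
  ext ⟨⟨i, l⟩, b⟩
  cases b <;> simp [dec, enc, realify]

theorem enc_sub (a b : Coeff d K ι) : enc (a - b) = enc a - enc b := by
  ext ⟨⟨i, l⟩, t⟩
  cases t <;> simp [enc, realify]

theorem norm_realify (z : EuclideanSpace ℂ κ) : ‖realify z‖ = ‖z‖ := by
  rw [EuclideanSpace.norm_eq, EuclideanSpace.norm_eq, Fintype.sum_prod_type]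
  congr 1
  refine Finset.sum_congr rfl fun j _ => ?_
  rw [Fintype.sum_bool, Complex.sq_norm, Complex.normSq_apply]
  simp only [realify, Real.norm_eq_abs, sq_abs, if_true]
  simp
  ring

theorem norm_enc (c : Coeff d K ι) : ‖enc c‖ = ‖c‖ := by
  rw [enc, norm_realify, ← sq_eq_sq₀ (norm_nonneg _) (norm_nonneg _), EuclideanSpace.norm_sq_eq,
    PiLp.norm_sq_eq_of_L2, Fintype.sum_prod_type]
  simp_rw [EuclideanSpace.norm_sq_eq]

theorem continuous_enc : Continuous (enc : Coeff d K ι → _) := by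
  refine (PiLp.continuous_toLp 2 _).comp (continuous_pi fun a => ?_)
  obtain ⟨⟨i, l⟩, b⟩ := a
  cases b <;> simp <;> fun_prop

theorem continuous_dec : Continuous (dec ι : _ → Coeff d K ι) := by
  refine (PiLp.continuous_toLp 2 _).comp (continuous_pi fun i =>
    (PiLp.continuous_toLp 2 _).comp (continuous_pi fun l => ?_))
  exact Complex.equivRealProdCLM.symm.continuous.comp (f := fun y : EuclideanSpace ℝ _ =>
    ((y ((i, l), false), y ((i, l), true)) : ℝ × ℝ)) (by fun_prop)

omit [Fintype κ] in
theorem complexify_realify (z : EuclideanSpace ℂ κ) : complexify (realify z) = z := by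
  ext j
  simp [complexify, realify]

omit [Fintype κ] in
theorem realify_complexify (y : EuclideanSpace ℝ (κ × Bool)) : realify (complexify y) = y := by
  ext ⟨j, b⟩
  cases b <;> simp [complexify, realify]

omit [Fintype κ] in
theorem realify_sub (a b : EuclideanSpace ℂ κ) : realify (a - b) = realify a - realify b := by
  ext ⟨j, t⟩
  cases t <;> simp [realify]

omit [Fintype κ] in
theorem continuous_realify : Continuous (realify : EuclideanSpace ℂ κ → _) := by
  refine (PiLp.continuous_toLp 2 _).comp (continuous_pi fun a => ?_)
  obtain ⟨j, b⟩ := a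
  cases b <;> simp <;> fun_prop

omit [Fintype κ] in
theorem continuous_complexify : Continuous (complexify : _ → EuclideanSpace ℂ κ) := by
  refine (PiLp.continuous_toLp 2 _).comp (continuous_pi fun l => ?_)
  exact Complex.equivRealProdCLM.symm.continuous.comp (f := fun y : EuclideanSpace ℝ (κ × Bool) =>
    ((y (l, false), y (l, true)) : ℝ × ℝ)) (by fun_prop)

end Encoding

/-! ### Spectral layers -/

/-- Conjugation by the invertible transform permutes the matrices, so inserting it costs no
expressive power. This is the only place where the two architectures are told apart in the
construction of operators. -/
theorem Arch.exists_mul_eq (arch : Arch) {n : ℕ} [NeZero n] (B : Matrix (ZMod n) (ZMod n) ℂ) :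
    ∃ A, ∀ z, arch.mul A z = B.mulVec z := by
  cases arch with
  | fno => exact ⟨B, fun z => rfl⟩
  | skno =>
    let F : (ZMod n → ℂ) ≃ₗ[ℂ] (ZMod n → ℂ) := ZMod.dft
    refine ⟨LinearMap.toMatrix' (F.toLinearMap ∘ₗ Matrix.toLin' B ∘ₗ F.symm.toLinearMap),
      fun z => ?_⟩
    simp [Arch.mul, LinearMap.toMatrix'_mulVec, F]

/-- The argument of the activation in a purely spectral layer: a trigonometric polynomial whose
coefficients are affine functions of the Fourier coefficients of the input. -/
def features [Fintype ι] (T : Modes d K → Matrix μ ι ℂ) (γ : Modes d K → μ → ℂ)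
    (f : Torus d → ι → ℝ) (x : Torus d) : EuclideanSpace ℝ μ :=
  WithLp.toLp 2 fun a => (∑ i, ((T i).mulVec
    (fun l => UnitAddTorus.mFourierCoeff (fun y => ((f y l : ℝ) : ℂ)) (freq i)) a + γ i a)
      * UnitAddTorus.mFourier (freq i) x).re

/-- A layer has equal input and output channels and always adds its input. Inputs and hidden units
therefore share one channel axis, and the residual weight `-1` removes the input again, so that the
activation sees only the spectral part. -/
theorem NeuralOp.exists_eval_spectral (σ : ℝ → ℝ) (arch : Arch) {H : Type} [Fintype ι] [Fintype H]
    (B : Modes d K → Matrix H ι ℂ) (β : Modes d K → H → ℂ) (C : Matrix κ H ℝ) :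
    ∃ N : NeuralOp d ι κ, ∀ f x, N.eval σ arch f x
      = C.mulVec fun h => σ (features B β f x h) := by
  classical
  let m := Fintype.card (ι ⊕ H) + 1
  -- The padding channel `none` keeps the number of channels positive.
  let e : Option (ι ⊕ H) ≃ ZMod m :=
    (Fintype.equivFinOfCardEq (by simp [m])).trans (ZMod.finEquiv m).toEquiv
  let L : Matrix (ZMod m) ι ℝ := fun t l => if e.symm t = some (.inl l) then 1 else 0
  let B' : Modes d K → Option (ι ⊕ H) → Option (ι ⊕ H) → ℂ := fun i t t' =>
    match t, t' with
    | some (.inr h), some (.inl l) => B i h l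
    | _, _ => 0
  let β' : Modes d K → Option (ι ⊕ H) → ℂ := fun i t =>
    match t with
    | some (.inr h) => β i h
    | _ => 0
  let C' : κ → Option (ι ⊕ H) → ℝ := fun j t =>
    match t with
    | some (.inr h) => C j h
    | _ => 0
  choose A hA using fun i : Modes d K => arch.exists_mul_eq
    (n := m) (fun t t' => B' i (e.symm t) (e.symm t'))
  refine ⟨.comp (.lin L) (.comp (.layer m (-1) K A fun i t => β' i (e.symm t))
    (.lin fun j t => C' j (e.symm t))), fun f x => ?_⟩
  have hL : ∀ y l, L.mulVec (f y) (e (some (.inl l))) = f y l := by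
    intro y l
    simp [Matrix.mulVec, dotProduct, L]
  funext j
  simp only [NeuralOp.eval]
  change ∑ t : ZMod m, _ * _ = ∑ h : H, _ * _
  rw [← e.sum_comp, Fintype.sum_option,
    Fintype.sum_sum_type]
  simp only [Equiv.symm_apply_apply, C', zero_mul, Finset.sum_const_zero, zero_add]
  refine Finset.sum_congr rfl fun h _ => ?_
  congr 2
  rw [Matrix.neg_mulVec, Matrix.one_mulVec, Pi.neg_apply, add_neg_cancel, zero_add]
  simp only [features, hA, β']
  congr 1
  refine Finset.sum_congr rfl fun i _ => ?_
  congr 2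
  change ∑ t : ZMod m, _ * _ = ∑ l : ι, _ * _
  rw [← e.sum_comp, Fintype.sum_option,
    Fintype.sum_sum_type]
  simp only [Equiv.symm_apply_apply, B', zero_mul, Finset.sum_const_zero, zero_add, add_zero, hL]

/-- The zero frequency among the retained modes. -/
def zeroMode (d K : ℕ) : Modes d K := fun _ => ⟨0, by simp⟩

theorem freq_zeroMode : freq (zeroMode d K) = 0 := rfl

/-- A network applied to spectral features is a neural operator. -/
theorem NeuralOp.exists_eval_features (σ : ℝ → ℝ) (arch : Arch) [Fintype ι] [Fintype μ]
    (Φ : NN μ κ) (T : Modes d K → Matrix μ ι ℂ) (γ : Modes d K → μ → ℂ) :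
    ∃ N : NeuralOp d ι κ, ∀ f x, N.eval σ arch f x
      = WithLp.ofLp (Φ.eval σ (features T γ f x)) := by
  classical
  -- The first-layer weights are real, hence commute with the real part and can be absorbed into the
  -- spectral weights; the constant biases of the network go into the zero mode.
  obtain ⟨N, hN⟩ := NeuralOp.exists_eval_spectral σ arch
    (fun i => (Φ.A.map Complex.ofReal) * T i)
    (fun i h => (Φ.A.map Complex.ofReal).mulVec (γ i) h
      + if i = zeroMode d K then (Φ.b h : ℂ) else 0) Φ.C
  refine ⟨N, fun f x => ?_⟩
  rw [hN]
  simp only [NN.eval]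
  congr 1
  funext h
  congr 1
  have hA : ∀ (w : μ → ℂ), Φ.A.mulVec (fun a => (w a).re) h
      = ((Φ.A.map Complex.ofReal).mulVec w h).re := by
    intro w
    simp [Matrix.mulVec, dotProduct]
  simp only [features]
  rw [hA, ← Complex.ofReal_re (Φ.b h), ← Complex.add_re, Complex.ofReal_re]
  congr 1
  have h1 : ∀ i, ((Φ.A.map Complex.ofReal) * T i).mulVec (fun l =>
      UnitAddTorus.mFourierCoeff (fun y => ((f y l : ℝ) : ℂ)) (freq i)) h
      = (Φ.A.map Complex.ofReal).mulVec ((T i).mulVec (fun l =>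
      UnitAddTorus.mFourierCoeff (fun y => ((f y l : ℝ) : ℂ)) (freq i))) h := by
    intro i
    rw [Matrix.mulVec_mulVec]
  simp only [h1, ← add_assoc, ← Pi.add_apply, ← Matrix.mulVec_add]
  simp only [Pi.add_apply, add_mul, ite_mul, zero_mul]
  rw [Finset.sum_add_distrib, Finset.sum_ite_eq' Finset.univ (zeroMode d K)]
  simp only [Finset.mem_univ, if_true, freq_zeroMode, UnitAddTorus.mFourier_zero,
    ContinuousMap.one_apply, mul_one]
  congr 1
  have h2 : ∀ (z : Modes d K → μ → ℂ) (w : Modes d K → ℂ),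
      ∑ i, (Φ.A.map Complex.ofReal).mulVec (z i) h * w i
        = (Φ.A.map Complex.ofReal).mulVec (fun a => ∑ i, z i a * w i) h := by
    intro z w
    simp only [Matrix.mulVec, dotProduct, Finset.sum_mul, Finset.mul_sum, mul_assoc]
    rw [Finset.sum_comm]
  simp only [← add_mul]
  exact h2 (fun i => (T i).mulVec (fun l =>
    UnitAddTorus.mFourierCoeff (fun y => ((f y l : ℝ) : ℂ)) (freq i)) + γ i) _

theorem continuous_features [Fintype ι] (T : Modes d K → Matrix μ ι ℂ) (γ : Modes d K → μ → ℂ)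
    (f : Torus d → ι → ℝ) : Continuous (features T γ f) := by
  unfold features
  fun_prop

end

section

variable {d K : ℕ} {ι κ μ : Type} [Fintype ι] [Fintype κ] [Fintype μ]

/-! ### Approximate forward transforms -/

theorem norm_mFourier_apply (k : Fin d → ℤ) (x : Torus d) : ‖UnitAddTorus.mFourier k x‖ = 1 := by
  have h : UnitAddTorus.mFourier k x * (starRingEnd ℂ) (UnitAddTorus.mFourier k x) = 1 := by
    rw [← UnitAddTorus.mFourier_neg, ← UnitAddTorus.mFourier_add, add_neg_cancel,
      UnitAddTorus.mFourier_zero, ContinuousMap.one_apply]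
  rw [Complex.mul_conj, Complex.normSq_eq_norm_sq] at h
  have h2 : ‖UnitAddTorus.mFourier k x‖ ^ 2 = 1 := by exact_mod_cast h
  exact (pow_eq_one_iff_of_nonneg (norm_nonneg _) two_ne_zero).1 h2

theorem mFourier_mul_conj (k : Fin d → ℤ) (x : Torus d) :
    UnitAddTorus.mFourier k x * (starRingEnd ℂ) (UnitAddTorus.mFourier k x) = 1 := by
  rw [Complex.mul_conj, Complex.normSq_eq_norm_sq, norm_mFourier_apply]
  simp

/-- Multiplying by `part b` extracts the real (`false`) or imaginary (`true`) part. -/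
def part (b : Bool) : ℂ := if b then -Complex.I else 1

theorem re_part_mul (b : Bool) (z : ℂ) : (part b * z).re = if b then z.im else z.re := by
  cases b <;> simp [part]

theorem abs_re_part_mul_le (b : Bool) (z : ℂ) : |(part b * z).re| ≤ ‖z‖ := by
  refine (Complex.abs_re_le_norm _).trans ?_
  cases b <;> simp [part]

open Classical in
/-- Weights of the modulated coefficients `v̂(k) e_k`. -/
def waveWeights (d K : ℕ) (ι : Type) (i : Modes d K) :
    Matrix (((Modes d K × ι) × Bool) ⊕ (Modes d K × Bool)) ι ℂ := fun a l =>
  match a with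
  | .inl ((i', l'), b) => if i' = i ∧ l' = l then part b else 0
  | .inr _ => 0

open Classical in
/-- Biases producing the exponentials `e_k`. -/
def waveBias (d K : ℕ) (μ : Type) (i : Modes d K) : μ ⊕ (Modes d K × Bool) → ℂ
  | .inl _ => 0
  | .inr (i', b) => if i' = i then part b else 0

theorem features_wave_inl (f : Torus d → ι → ℝ) (x : Torus d) (i : Modes d K) (l : ι) (b : Bool) :
    features (waveWeights d K ι) (waveBias d K _) f x (.inl ((i, l), b))
      = (part b * (UnitAddTorus.mFourierCoeff (fun y => ((f y l : ℝ) : ℂ)) (freq i)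
        * UnitAddTorus.mFourier (freq i) x)).re := by
  classical
  simp only [features, waveBias, Matrix.mulVec, dotProduct, waveWeights, ite_and, ite_mul,
    zero_mul, add_zero]
  rw [Finset.sum_eq_single i]
  · simp [mul_assoc]
  · intro i' _ hi'
    simp [Ne.symm hi']
  · simp

omit [Fintype μ] in
theorem features_inr_of_weights_eq_zero {T : Modes d K → Matrix (μ ⊕ (Modes d K × Bool)) ι ℂ}
    (hT : ∀ i a l, T i (.inr a) l = 0) (f : Torus d → ι → ℝ) (x : Torus d) (i : Modes d K)
    (b : Bool) : features T (waveBias d K μ) f x (.inr (i, b))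
      = (part b * UnitAddTorus.mFourier (freq i) x).re := by
  classical
  simp only [features, waveBias, Matrix.mulVec, dotProduct, hT, zero_mul, Finset.sum_const_zero,
    zero_add, ite_mul]
  rw [Finset.sum_ite_eq Finset.univ i]
  simp

/-- Demodulation: `(v̂(k) e_k, e_k) ↦ v̂(k)`, in real coordinates. -/
def demod (d K : ℕ) (ι : Type)
    (y : EuclideanSpace ℝ (((Modes d K × ι) × Bool) ⊕ (Modes d K × Bool))) :
    EuclideanSpace ℝ ((Modes d K × ι) × Bool) :=
  WithLp.toLp 2 fun a =>
    if a.2 then y (.inl (a.1, true)) * y (.inr (a.1.1, false))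
        - y (.inl (a.1, false)) * y (.inr (a.1.1, true))
      else y (.inl (a.1, false)) * y (.inr (a.1.1, false))
        + y (.inl (a.1, true)) * y (.inr (a.1.1, true))

omit [Fintype ι] in
theorem continuous_demod : Continuous (demod d K ι) := by
  refine (PiLp.continuous_toLp 2 _).comp (continuous_pi fun a => ?_)
  obtain ⟨a, b⟩ := a
  cases b <;> simp <;> fun_prop

/-- As `|e_k| = 1`, multiplying `v̂(k) e_k` by the conjugate of `e_k` returns `v̂(k)` at every point
`x`. -/
theorem demod_features (f : Torus d → EuclideanSpace ℝ ι) (x : Torus d) :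
    demod d K ι (features (waveWeights d K ι) (waveBias d K _) (fun y => WithLp.ofLp (f y)) x)
      = enc (fwd K f) := by
  ext ⟨⟨i, l⟩, b⟩
  have h1 := mFourier_mul_conj (freq i) x
  set e := UnitAddTorus.mFourier (freq i) x
  have h2 : ((fwd K f) i l) = UnitAddTorus.mFourierCoeff (fun y => ((f y l : ℝ) : ℂ)) (freq i) :=
    rfl
  set z := (fwd K f) i l
  have h3 : z = z * e * (starRingEnd ℂ) e := by rw [mul_assoc, h1, mul_one]
  cases b
  · simp only [demod, enc, realify, features_wave_inl, re_part_mul,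
      features_inr_of_weights_eq_zero (T := waveWeights d K ι) (fun _ _ _ => rfl), ← h2]
    simp only [Bool.false_eq_true, if_false, if_true]
    conv_rhs => rw [show (fwd K f).ofLp i l = z from rfl, h3]
    simp [e]
  · simp only [demod, enc, realify, features_wave_inl, re_part_mul,
      features_inr_of_weights_eq_zero (T := waveWeights d K ι) (fun _ _ _ => rfl), ← h2]
    simp only [Bool.false_eq_true, if_false, if_true]
    conv_rhs => rw [show (fwd K f).ofLp i l = z from rfl, h3]
    simp [e]
    ring

omit [Fintype κ] in
/-- A network applied to the mean value of the input is a neural operator. -/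
theorem NeuralOp.exists_eval_mean (σ : ℝ → ℝ) (arch : Arch) (d : ℕ) (Φ : NN μ κ) :
    ∃ N : NeuralOp d μ κ, ∀ f : Torus d → EuclideanSpace ℝ μ, ∀ x, N.app σ arch f x
      = Φ.eval σ (WithLp.toLp 2 fun a => ∫ y, f y a ∂(haarT d)) := by
  classical
  obtain ⟨N, hN⟩ := NeuralOp.exists_eval_features (d := d) (K := 0) σ arch Φ
    (fun _ => (1 : Matrix μ μ ℂ)) 0
  refine ⟨N, fun f x => ?_⟩
  have hu : ∀ i : Modes d 0, i = zeroMode d 0 := by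
    intro i
    funext j
    have := (i j).2
    simp only [Nat.cast_zero, neg_zero, Finset.Icc_self, Finset.mem_singleton] at this
    exact Subtype.ext this
  rw [NeuralOp.app, hN, WithLp.toLp_ofLp]
  congr 1
  ext a
  simp only [features, Matrix.one_mulVec, Pi.zero_apply, add_zero]
  rw [Fintype.sum_eq_single (zeroMode d 0) fun i hi => absurd (hu i) hi]
  simp only [freq_zeroMode, UnitAddTorus.mFourier_zero, ContinuousMap.one_apply, mul_one]
  change (∫ y, UnitAddTorus.mFourier (-0) y • ((f y a : ℝ) : ℂ) ∂(haarT d)).re = _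
  simp only [neg_zero, UnitAddTorus.mFourier_zero, ContinuousMap.one_apply, one_smul]
  exact congrArg Complex.re (integral_ofReal (𝕜 := ℂ))

/-- Any continuous function of the truncated Fourier coefficients is approximated by neural
operators with constant outputs. -/
theorem NeuralOp.exists_approx_forward {σ : ℝ → ℝ} (hc : Continuous σ)
    (hσ : ¬ ∃ q : Polynomial ℝ, ∀ x, σ x = q.eval x) (arch : Arch)
    {τ : EuclideanSpace ℝ ((Modes d K × ι) × Bool) → EuclideanSpace ℝ κ} (hτ : Continuous τ)
    (R : ℝ) {ε : ℝ} (hε : 0 < ε) :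
    ∃ N : NeuralOp d ι κ, ∀ v : L2 d ι, ‖v‖ ≤ R →
      ∃ y, (∀ x, N.app σ arch v x = y) ∧ ‖y - τ (enc (fwd K v))‖ ≤ ε := by
  -- Radius `R + 1` leaves room for the error of the averaged coefficients, which is kept at most
  -- `1`.
  let B : Set (EuclideanSpace ℝ ((Modes d K × ι) × Bool)) := Metric.closedBall 0 (R + 1)
  have hB : IsCompact B := isCompact_closedBall _ _
  obtain ⟨Ψ, hΨ⟩ := NN.exists_eval_approx hc hσ hB hτ.continuousOn (half_pos hε)
  obtain ⟨δ, hδ, hτδ⟩ := Metric.uniformContinuousOn_iff.1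
    (hB.uniformContinuousOn_of_continuous hτ.continuousOn) (ε / 2) (half_pos hε)
  let m : ℝ := Fintype.card ((Modes d K × ι) × Bool) + 1
  have hm : 0 < m := by positivity
  -- Coordinatewise errors are summed to bound the norm, hence the division by the number of
  -- coordinates.
  let δ' : ℝ := min (δ / 2) 1 / m
  have hδ' : 0 < δ' := by positivity
  -- Modulated coefficients are bounded by `R`, exponentials by `1`.
  let R' : ℝ := max R 1
  let X : Set (EuclideanSpace ℝ (((Modes d K × ι) × Bool) ⊕ (Modes d K × Bool))) :=
    Metric.closedBall 0 (Fintype.card (((Modes d K × ι) × Bool) ⊕ (Modes d K × Bool)) * R')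
  obtain ⟨Φ, hΦ⟩ := NN.exists_eval_approx hc hσ (isCompact_closedBall _ _ : IsCompact X)
    (continuous_demod (d := d) (K := K) (ι := ι)).continuousOn hδ'
  obtain ⟨N₁, hN₁⟩ := NeuralOp.exists_eval_features (d := d) σ arch Φ
    (waveWeights d K ι) (waveBias d K _)
  -- The demodulated output is only nearly constant in `x`. Taking its mean makes it exactly
  -- constant and preserves each coordinate's error bound; `Ψ` then approximates `τ` at this mean.
  obtain ⟨N₂, hN₂⟩ := NeuralOp.exists_eval_mean σ arch d Ψ
  refine ⟨N₁.comp N₂, fun v hv => ?_⟩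
  let g : Torus d → EuclideanSpace ℝ ((Modes d K × ι) × Bool) := fun x =>
    Φ.eval σ (features (waveWeights d K ι) (waveBias d K _) (fun y => WithLp.ofLp (v y)) x)
  have hg : Continuous g := (NN.continuous_eval hc Φ).comp (continuous_features _ _ _)
  have happ : ∀ x, (N₁.comp N₂).app σ arch v x = N₂.app σ arch g x := by
    intro x
    simp only [NeuralOp.app, NeuralOp.eval]
    congr 2
    funext y
    rw [hN₁]
  let M : EuclideanSpace ℝ ((Modes d K × ι) × Bool) :=
    WithLp.toLp 2 fun a => ∫ y, g y a ∂(haarT d)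
  have hle : ‖enc (fwd K v)‖ ≤ R := by
    rw [norm_enc]
    exact (norm_fwd_le v).trans hv
  have hfeat : ∀ x, features (waveWeights d K ι) (waveBias d K _)
      (fun y => WithLp.ofLp (v y)) x ∈ X := by
    intro x
    rw [mem_closedBall_zero_iff]
    refine norm_le_card_mul _ fun a => ?_
    rcases a with ⟨⟨i, l⟩, b⟩ | ⟨i, b⟩
    · rw [features_wave_inl]
      refine (abs_re_part_mul_le _ _).trans ?_
      rw [norm_mul, norm_mFourier_apply, mul_one]
      refine le_trans ?_ (le_max_left R 1)
      refine le_trans ?_ ((norm_coeff_le v (freq i)).trans hv)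
      exact PiLp.norm_apply_le (coeff v (freq i)) l
    · rw [features_inr_of_weights_eq_zero (T := waveWeights d K ι) (fun _ _ _ => rfl)]
      refine (abs_re_part_mul_le _ _).trans ?_
      rw [norm_mFourier_apply]
      exact le_max_right R 1
  have hgx : ∀ x, ‖g x - enc (fwd K v)‖ ≤ δ' := by
    intro x
    have := hΦ _ (hfeat x)
    rwa [demod_features] at this
  have hM : ‖M - enc (fwd K v)‖ ≤ min (δ / 2) 1 := by
    refine (norm_le_card_mul (δ := δ') _ fun a => ?_).trans ?_
    · have hi : Integrable (fun y => g y a) (haarT d) := by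
        refine Continuous.integrable_of_hasCompactSupport ?_ (HasCompactSupport.of_compactSpace _)
        fun_prop
      have h1 : (M - enc (fwd K v)) a = ∫ y, (g y a - enc (fwd K v) a) ∂(haarT d) := by
        rw [integral_sub hi (integrable_const _)]
        simp [M]
      rw [h1, ← Real.norm_eq_abs]
      refine (norm_integral_le_of_norm_le_const (C := δ') (ae_of_all _ fun y => ?_)).trans ?_
      · exact (PiLp.norm_apply_le (g y - enc (fwd K v)) a).trans (hgx y)
      · simp
    · simp only [δ']
      rw [mul_div_assoc', div_le_iff₀ hm, mul_comm]
      refine mul_le_mul_of_nonneg_left ?_ (by positivity)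
      simp [m]
  have hMB : M ∈ B := by
    rw [mem_closedBall_zero_iff]
    have := norm_le_norm_add_norm_sub' M (enc (fwd K v))
    have := hM.trans (min_le_right _ _)
    linarith
  have hEB : enc (fwd K v) ∈ B := by
    rw [mem_closedBall_zero_iff]
    linarith
  refine ⟨Ψ.eval σ M, fun x => (happ x).trans (hN₂ g x), ?_⟩
  have h1 := hΨ M hMB
  have h2 := hτδ M hMB _ hEB (by
    rw [dist_eq_norm]
    exact (hM.trans (min_le_left _ _)).trans_lt (half_lt_self hδ))
  rw [dist_eq_norm] at h2
  have h3 := norm_sub_le_norm_sub_add_norm_sub (Ψ.eval σ M) (τ M) (τ (enc (fwd K v)))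
  linarith

/-! ### Approximate inverse transforms -/

open Classical in
/-- Weights copying a constant input. -/
def copyWeights (d K : ℕ) (μ : Type) (i : Modes d K) : Matrix (μ ⊕ (Modes d K × Bool)) μ ℂ :=
  fun a l =>
  match a with
  | .inl l' => if l' = l ∧ i = zeroMode d K then 1 else 0
  | .inr _ => 0

theorem features_copy_inl (c : EuclideanSpace ℝ μ) (x : Torus d) (a : μ) :
    features (copyWeights d K μ) (waveBias d K μ) (fun _ => WithLp.ofLp c) x (.inl a) = c a := by
  classical
  simp only [features, waveBias, Matrix.mulVec, dotProduct, copyWeights, ite_and, ite_mul,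
    zero_mul, add_zero, one_mul]
  rw [Finset.sum_eq_single (zeroMode d K)]
  · simp only [if_true, Finset.sum_ite_eq, Finset.mem_univ, freq_zeroMode,
      UnitAddTorus.mFourier_zero, ContinuousMap.one_apply, mul_one]
    change (∫ y, UnitAddTorus.mFourier (-0) y • ((c a : ℝ) : ℂ) ∂(haarT d)).re = _
    simp [UnitAddTorus.mFourier_zero]
  · intro i' _ hi'
    simp [hi']
  · simp

/-- The synthesis as a function of the coefficients and of the values of the exponentials. -/
def modulate (T : Coeff d K ι → Coeff d K ι)
    (y : EuclideanSpace ℝ (((Modes d K × ι) × Bool) ⊕ (Modes d K × Bool))) : EuclideanSpace ℝ ι :=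
  WithLp.toLp 2 fun j => ∑ i,
    ((T (dec ι (WithLp.toLp 2 fun a => y (.inl a))) i j).re * y (.inr (i, false))
      - (T (dec ι (WithLp.toLp 2 fun a => y (.inl a))) i j).im * y (.inr (i, true)))

theorem continuous_modulate {T : Coeff d K ι → Coeff d K ι} (hT : Continuous T) :
    Continuous (modulate T) := by
  have h1 : Continuous fun y : EuclideanSpace ℝ (((Modes d K × ι) × Bool) ⊕ (Modes d K × Bool)) =>
      T (dec ι (WithLp.toLp 2 fun a => y (.inl a))) := by
    refine hT.comp (continuous_dec.comp ((PiLp.continuous_toLp 2 _).comp ?_))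
    fun_prop
  refine (PiLp.continuous_toLp 2 _).comp (continuous_pi fun j => continuous_finsetSum _ fun i _ => ?_)
  have h2 := (PiLp.continuous_apply 2 (fun _ => ℂ) j).comp
    ((PiLp.continuous_apply 2 (fun _ : Modes d K => EuclideanSpace ℂ ι) i).comp h1)
  exact ((Complex.continuous_re.comp h2).mul (PiLp.continuous_apply 2 _ _)).sub
    ((Complex.continuous_im.comp h2).mul (PiLp.continuous_apply 2 _ _))

/-- For a constant input the features are the coefficients themselves and the exponentials at `x`,
which are all that pointwise synthesis needs. The map `T` lets the inverse transform in `p` be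
absorbed into the same network. -/
theorem modulate_features (T : Coeff d K ι → Coeff d K ι) (c : Coeff d K ι) (x : Torus d) :
    modulate T (features (copyWeights d K _) (waveBias d K _) (fun _ => WithLp.ofLp (enc c)) x)
      = synthFun (T c) x := by
  ext j
  simp only [modulate, features_copy_inl, synthFun, WithLp.toLp_ofLp, dec_enc, Complex.re_sum,
    features_inr_of_weights_eq_zero (T := copyWeights d K _) (fun _ _ _ => rfl), re_part_mul]
  simp [Complex.mul_re]

/-- The synthesis of any continuous function of the coefficients is approximated by neural
operators on constant inputs. -/
theorem NeuralOp.exists_approx_inverse {σ : ℝ → ℝ} (hc : Continuous σ)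
    (hσ : ¬ ∃ q : Polynomial ℝ, ∀ x, σ x = q.eval x) (arch : Arch)
    {T : Coeff d K ι → Coeff d K ι} (hT : Continuous T) (R : ℝ) {ε : ℝ} (hε : 0 < ε) :
    ∃ N : NeuralOp d ((Modes d K × ι) × Bool) ι, ∀ c : Coeff d K ι, ‖c‖ ≤ R →
      ∀ x, ‖N.app σ arch (fun _ => enc c) x - synthFun (T c) x‖ ≤ ε := by
  let R' : ℝ := max R 1
  let X : Set (EuclideanSpace ℝ (((Modes d K × ι) × Bool) ⊕ (Modes d K × Bool))) :=
    Metric.closedBall 0 (Fintype.card (((Modes d K × ι) × Bool) ⊕ (Modes d K × Bool)) * R')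
  obtain ⟨Φ, hΦ⟩ := NN.exists_eval_approx hc hσ (isCompact_closedBall _ _ : IsCompact X)
    (continuous_modulate hT).continuousOn hε
  obtain ⟨N, hN⟩ := NeuralOp.exists_eval_features (d := d) σ arch Φ
    (copyWeights d K ((Modes d K × ι) × Bool)) (waveBias d K _)
  refine ⟨N, fun c hcR x => ?_⟩
  rw [← modulate_features, NeuralOp.app, hN, WithLp.toLp_ofLp]
  refine hΦ _ ?_
  rw [mem_closedBall_zero_iff]
  refine norm_le_card_mul _ fun a => ?_
  rcases a with a | ⟨i, b⟩
  · rw [features_copy_inl]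
    refine ((PiLp.norm_apply_le (enc c) a).trans ?_).trans (le_max_left R 1)
    rwa [norm_enc]
  · rw [features_inr_of_weights_eq_zero (T := copyWeights d K _) (fun _ _ _ => rfl)]
    refine (abs_re_part_mul_le _ _).trans ?_
    rw [norm_mFourier_apply]
    exact le_max_right R 1

end

section

/-! ### The discrete Fourier transform in the auxiliary variable -/

section DFT

variable {d K n : ℕ} [NeZero n]

/-- The forward transform is unnormalised and its inverse carries the factor `1/n`; expanding one
factor of `|f̂|²` and applying inversion leaves `n`. -/
theorem sum_norm_sq_dft (f : ZMod n → ℂ) :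
    ∑ k, ‖ZMod.dft f k‖ ^ 2 = n * ∑ j, ‖f j‖ ^ 2 := by
  have hn : (n : ℂ) ≠ 0 := NeZero.ne _
  have h1 : ∀ k, (starRingEnd ℂ) (ZMod.dft f k)
      = ∑ j, ZMod.stdAddChar (j * k) * (starRingEnd ℂ) (f j) := by
    intro k
    rw [ZMod.dft_apply, map_sum]
    refine Finset.sum_congr rfl fun j _ => ?_
    rw [smul_eq_mul, map_mul, AddChar.map_neg_eq_conj, Complex.conj_conj]
  have h2 : ∀ j, ∑ k, ZMod.stdAddChar (j * k) * ZMod.dft f k = n * f j := by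
    intro j
    have h := congrFun (ZMod.dft.symm_apply_apply f) j
    rw [ZMod.invDFT_apply, inv_smul_eq_iff₀ hn, smul_eq_mul] at h
    rw [← h]
    refine Finset.sum_congr rfl fun k _ => ?_
    rw [mul_comm j k, smul_eq_mul]
  have h3 : ((∑ k, ‖ZMod.dft f k‖ ^ 2 : ℝ) : ℂ) = ((n * ∑ j, ‖f j‖ ^ 2 : ℝ) : ℂ) := by
    push_cast
    simp_rw [← Complex.conj_mul', h1, Finset.sum_mul]
    rw [Finset.sum_comm, Finset.mul_sum]
    refine Finset.sum_congr rfl fun j _ => ?_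
    calc ∑ k, ZMod.stdAddChar (j * k) * (starRingEnd ℂ) (f j) * ZMod.dft f k
        = (starRingEnd ℂ) (f j) * ∑ k, ZMod.stdAddChar (j * k) * ZMod.dft f k := by
          rw [Finset.mul_sum]
          exact Finset.sum_congr rfl fun k _ => by ring
      _ = _ := by rw [h2]; ring
  exact_mod_cast h3

theorem norm_sq_dftP (z : EuclideanSpace ℂ (ZMod n)) : ‖dftP z‖ ^ 2 = n * ‖z‖ ^ 2 := by
  rw [EuclideanSpace.norm_sq_eq, EuclideanSpace.norm_sq_eq]
  exact sum_norm_sq_dft _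

theorem dftP_sub (a b : EuclideanSpace ℂ (ZMod n)) : dftP (a - b) = dftP a - dftP b := by
  ext j
  simp [dftP]

theorem pDFT_sub (a b : Coeff d K (ZMod n)) : pDFT (a - b) = pDFT a - pDFT b := by
  ext i : 1
  exact dftP_sub (a i) (b i)

theorem norm_sq_pDFT (c : Coeff d K (ZMod n)) : ‖pDFT c‖ ^ 2 = n * ‖c‖ ^ 2 := by
  rw [PiLp.norm_sq_eq_of_L2, PiLp.norm_sq_eq_of_L2, Finset.mul_sum]
  exact Finset.sum_congr rfl fun i _ => norm_sq_dftP (c i)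

theorem norm_pDFT (c : Coeff d K (ZMod n)) : ‖pDFT c‖ = √n * ‖c‖ := by
  rw [← sq_eq_sq₀ (norm_nonneg _) (by positivity), norm_sq_pDFT, mul_pow,
    Real.sq_sqrt (Nat.cast_nonneg n)]

theorem pDFTInv_pDFT (c : Coeff d K (ZMod n)) : pDFTInv (pDFT c) = c := by
  ext i j
  simp [pDFTInv, pDFT, dftP]

/-- The inverse transform in `p` as a real-linear map. -/
def pDFTInvL (d K n : ℕ) [NeZero n] : Coeff d K (ZMod n) →ₗ[ℝ] Coeff d K (ZMod n) where
  toFun := pDFTInv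
  map_add' a b := by
    ext i j
    simp [pDFTInv]
  map_smul' r a := by
    ext i j
    have h := congrFun (map_smul (ZMod.dft (N := n) (E := ℂ)).symm (r : ℂ) (WithLp.ofLp (a i))) j
    simpa [pDFTInv] using! h

theorem continuous_dftP : Continuous (dftP : EuclideanSpace ℂ (ZMod n) → _) := by
  refine (PiLp.continuous_toLp 2 _).comp ?_
  exact (LinearMap.continuous_of_finiteDimensional
    (ZMod.dft (N := n) (E := ℂ)).toLinearMap).comp (PiLp.continuous_ofLp 2 _)

theorem continuous_pDFT : Continuous (pDFT : Coeff d K (ZMod n) → _) := by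
  refine (PiLp.continuous_toLp 2 _).comp (continuous_pi fun i => ?_)
  exact continuous_dftP.comp (PiLp.continuous_apply 2 _ i)

theorem continuous_pDFTInv : Continuous (pDFTInv : Coeff d K (ZMod n) → _) :=
  LinearMap.continuous_of_finiteDimensional (pDFTInvL d K n)

omit [NeZero n] in
theorem continuous_dropout (S : Finset (ZMod n)) : Continuous (dropout S) := by
  refine (PiLp.continuous_toLp 2 _).comp (continuous_pi fun j => ?_)
  split_ifs
  · exact PiLp.continuous_apply 2 _ j
  · exact continuous_const

theorem sqrt_natCast_pos (n : ℕ) [NeZero n] : 0 < √(n : ℝ) :=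
  Real.sqrt_pos.2 (Nat.cast_pos.2 (Nat.pos_of_ne_zero (NeZero.ne n)))

end DFT

/-! ### Conjugate maps -/

section Conj

variable {d K : ℕ} {s : ℝ} {ι : Type} [Fintype ι]

theorem projL2_proj_eq (M : Sob d s ι → L2 d ι) (v : Sob d s ι) :
    projL2 K (M (proj K v)) = synth (conjMap K M (spec K v)) := by
  rw [proj_eq]; rfl

theorem continuous_conjMap {M : Sob d s ι → L2 d ι} (hM : Continuous M) :
    Continuous (conjMap K M) :=
  continuous_fwd.comp (hM.comp continuous_synthSob)

theorem isHermitian_conjMap (M : Sob d s ι → L2 d ι) (c : Coeff d K ι) :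
    IsHermitian (conjMap K M c) :=
  isHermitian_fwd _

theorem norm_synth_sub (a b : Coeff d K ι) (ha : IsHermitian a) (hb : IsHermitian b) :
    ‖synth a - synth b‖ = ‖a - b‖ := by
  rw [← synth_sub, norm_synth _ (ha.sub hb)]

theorem norm_projL2_sub (M N : Sob d s ι → L2 d ι) (v : Sob d s ι) :
    ‖projL2 K (M (proj K v)) - projL2 K (N (proj K v))‖
      = ‖conjMap K M (spec K v) - conjMap K N (spec K v)‖ := by
  rw [projL2_proj_eq, projL2_proj_eq,
    norm_synth_sub _ _ (isHermitian_conjMap _ _) (isHermitian_conjMap _ _)]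

theorem conjMapP_pDFT {n : ℕ} [NeZero n] (M : Sob d s (ZMod n) → L2 d (ZMod n))
    (c : Coeff d K (ZMod n)) : conjMapP K M (pDFT c) = pDFT (conjMap K M c) := by
  rw [conjMapP, pDFTInv_pDFT]

theorem continuous_conjMapP {n : ℕ} [NeZero n] {M : Sob d s (ZMod n) → L2 d (ZMod n)}
    (hM : Continuous M) : Continuous (conjMapP K M) :=
  continuous_pDFT.comp ((continuous_conjMap hM).comp continuous_pDFTInv)

theorem tendstoUniformlyOn_image {α β γ δ : Type*} [UniformSpace γ] {F : α → β → γ} {f : β → γ}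
    {l : Filter α} {g : δ → β} {V : Set δ} :
    TendstoUniformlyOn F f l (g '' V)
      ↔ TendstoUniformlyOn (fun a v => F a (g v)) (fun v => f (g v)) l V := by
  simp only [TendstoUniformlyOn, Set.forall_mem_image]

theorem tendstoUniformlyOn_piLp {α β κ : Type*} [Fintype κ] {E : κ → Type*}
    [∀ i, NormedAddCommGroup (E i)] {F : α → β → PiLp 2 E} {f : β → PiLp 2 E} {l : Filter α}
    {V : Set β} :
    TendstoUniformlyOn F f l V
      ↔ ∀ i, TendstoUniformlyOn (fun a v => F a v i) (fun v => f v i) l V := by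
  constructor
  · intro h i
    rw [Metric.tendstoUniformlyOn_iff] at h ⊢
    intro ε hε
    filter_upwards [h ε hε] with a ha v hv
    refine lt_of_le_of_lt ?_ (ha v hv)
    rw [dist_eq_norm, dist_eq_norm]
    exact PiLp.norm_apply_le (f v - F a v) i
  · intro h
    rw [Metric.tendstoUniformlyOn_iff]
    intro ε hε
    let δ : ℝ := ε / (Fintype.card κ + 1)
    have hδ : 0 < δ := by positivity
    have h2 : ∀ᶠ a in l, ∀ i, ∀ v ∈ V, dist (f v i) (F a v i) < δ :=
      eventually_all.2 fun i => Metric.tendstoUniformlyOn_iff.1 (h i) δ hδ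
    filter_upwards [h2] with a ha v hv
    rw [dist_eq_norm, PiLp.norm_eq_of_L2]
    have h3 : ∑ i, ‖(f v - F a v) i‖ ^ 2 ≤ (Fintype.card κ * δ) ^ 2 := by
      refine (Finset.sum_sq_le_sq_sum_of_nonneg fun _ _ => norm_nonneg _).trans ?_
      gcongr
      refine (Finset.sum_le_card_nsmul _ _ δ fun i _ => ?_).trans ?_
      · rw [PiLp.sub_apply, ← dist_eq_norm]
        exact (ha i v hv).le
      · rw [nsmul_eq_mul, Finset.card_univ]
    refine (Real.sqrt_le_sqrt h3).trans_lt ?_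
    rw [Real.sqrt_sq (by positivity)]
    simp only [δ]
    rw [mul_div_assoc', div_lt_iff₀ (by positivity)]
    nlinarith

theorem tendstoUniformlyOn_projL2_iff {α : Type*} {l : Filter α} {V : Set (Sob d s ι)}
    (M : Sob d s ι → L2 d ι) (N : α → Sob d s ι → L2 d ι) :
    TendstoUniformlyOn (fun a v => projL2 K (N a (proj K v)))
        (fun v => projL2 K (M (proj K v))) l V
      ↔ TendstoUniformlyOn (fun a v => conjMap K (N a) (spec K v))
        (fun v => conjMap K M (spec K v)) l V := by
  simp only [Metric.tendstoUniformlyOn_iff, dist_eq_norm, norm_projL2_sub]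

theorem tendstoUniformlyOn_pDFT_iff {n : ℕ} [NeZero n] {α β : Type*} {l : Filter α} {V : Set β}
    {F : α → β → Coeff d K (ZMod n)} {f : β → Coeff d K (ZMod n)} :
    TendstoUniformlyOn (fun a v => pDFT (F a v)) (fun v => pDFT (f v)) l V
      ↔ TendstoUniformlyOn F f l V := by
  have hn := sqrt_natCast_pos n
  simp only [Metric.tendstoUniformlyOn_iff, dist_eq_norm, ← pDFT_sub, norm_pDFT]
  constructor
  · intro h ε hε
    filter_upwards [h (√n * ε) (by positivity)] with a ha v hv
    exact lt_of_mul_lt_mul_left (ha v hv) hn.le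
  · intro h ε hε
    filter_upwards [h (ε / √n) (by positivity)] with a ha v hv
    rw [← lt_div_iff₀' hn]
    exact ha v hv

/-- A map that factors a continuous map through a continuous image of a compact set is continuous
on this image. -/
theorem continuousOn_image_of_comp {X Y Z : Type*} [TopologicalSpace X] [TopologicalSpace Y]
    [T2Space Y] [TopologicalSpace Z] {V : Set X} (hV : IsCompact V) {p : X → Y} (hp : Continuous p)
    {q : X → Z} (hq : Continuous q) {m : Y → Z} (h : ∀ v ∈ V, q v = m (p v)) :
    ContinuousOn m (p '' V) := by
  have : CompactSpace V := isCompact_iff_compactSpace.1 hV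
  let g : V → p '' V := fun v => ⟨p v, v, v.2, rfl⟩
  have hg : Continuous g := (hp.comp continuous_subtype_val).subtype_mk _
  have hs : Function.Surjective g := by
    rintro ⟨_, v, hv, rfl⟩
    exact ⟨⟨v, hv⟩, rfl⟩
  -- A continuous surjection from a compact space onto a Hausdorff space is a quotient map, so
  -- continuity of `m` can be tested after composition.
  have hquot := hg.isClosedMap.isQuotientMap hg hs
  rw [continuousOn_iff_continuous_domRestrict, hquot.continuous_iff]
  have : (p '' V).domRestrict m ∘ g = fun v : V => q v := by
    funext v
    exact (h v v.2).symm
  rw [this]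
  exact hq.comp continuous_subtype_val

end Conj

/-! ### Networks approximating maps of complex vectors -/

section Networks

variable {ι κ : Type} [Fintype ι] [Fintype κ]

theorem NN.exists_complexify_approx {σ : ℝ → ℝ} (hc : Continuous σ)
    (hσ : ¬ ∃ q : Polynomial ℝ, ∀ x, σ x = q.eval x) {Z : Set (EuclideanSpace ℂ ι)}
    (hZ : IsCompact Z) {m : EuclideanSpace ℂ ι → EuclideanSpace ℂ κ} (hm : ContinuousOn m Z)
    {ε : ℝ} (hε : 0 < ε) :
    ∃ Φ : NN (ι × Bool) (κ × Bool), ∀ z ∈ Z,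
      ‖complexify (Φ.eval σ (realify z)) - m z‖ ≤ ε := by
  obtain ⟨Φ, hΦ⟩ := NN.exists_eval_approx hc hσ (hZ.image continuous_realify)
    (f := fun y => realify (m (complexify y))) (by
      refine continuous_realify.comp_continuousOn (hm.comp continuous_complexify.continuousOn ?_)
      rintro _ ⟨z, hz, rfl⟩
      rwa [complexify_realify]) hε
  refine ⟨Φ, fun z hz => ?_⟩
  have := hΦ _ ⟨z, hz, rfl⟩
  rwa [← realify_complexify (Φ.eval σ (realify z)), complexify_realify, ← realify_sub,
    norm_realify] at this

theorem NN.exists_enc_approx {d K : ℕ} {σ : ℝ → ℝ} (hc : Continuous σ)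
    (hσ : ¬ ∃ q : Polynomial ℝ, ∀ x, σ x = q.eval x) {Z : Set (Coeff d K ι)}
    (hZ : IsCompact Z) {m : Coeff d K ι → EuclideanSpace ℝ κ} (hm : Continuous m)
    {ε : ℝ} (hε : 0 < ε) :
    ∃ Φ : NN ((Modes d K × ι) × Bool) κ, ∀ c ∈ Z, ‖Φ.eval σ (enc c) - m c‖ ≤ ε := by
  obtain ⟨Φ, hΦ⟩ := NN.exists_eval_approx hc hσ (hZ.image continuous_enc)
    (f := fun y => m (dec ι y)) (hm.comp continuous_dec).continuousOn hε
  refine ⟨Φ, fun c hcZ => ?_⟩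
  have := hΦ _ ⟨c, hcZ, rfl⟩
  rwa [dec_enc] at this

end Networks

end

section

/-! ### Sampling in the auxiliary variable -/

variable {d n : ℕ} {r s : ℝ}

theorem summable_one_add_sq_rpow {q : ℝ} (hq : 1 / 2 < q) :
    Summable fun m : ℤ => (1 + (m : ℝ) ^ 2) ^ (-q) := by
  have h1 : Summable fun m : ℤ => |(m : ℝ)| ^ (-(2 * q)) :=
    Real.summable_abs_int_rpow (by linarith)
  -- The comparison with `|m| ^ (-2q)` is useless at `m = 0`, where the term is `1`; the indicator
  -- covers it.
  have h2 : Summable fun m : ℤ => if m = 0 then (1 : ℝ) else 0 := (hasSum_ite_eq 0 1).summable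
  refine Summable.of_nonneg_of_le (fun m => by positivity) (fun m => ?_) (h1.add h2)
  by_cases hm : m = 0
  · subst hm
    simp [Real.zero_rpow_nonneg]
  · have hm' : (0 : ℝ) < |(m : ℝ)| := abs_pos.2 (Int.cast_ne_zero.2 hm)
    rw [if_neg hm, add_zero, ← mul_neg, Real.rpow_mul hm'.le, Real.rpow_ofNat, sq_abs]
    exact Real.rpow_le_rpow_of_nonpos (by positivity) (by linarith) (by linarith)

theorem sobWeight_snoc (k : Fin d → ℤ) (m : ℤ) :
    sobWeight (Fin.snoc k m : Fin (d + 1) → ℤ) = sobWeight k + (m : ℝ) ^ 2 := by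
  simp [sobWeight, Fin.sum_univ_castSucc, add_assoc]

/-- The full weight dominates both the weight of `k` and `1 + m²`. Splitting `r/2 = s/2 + (r - s)/2`
uses one bound for each factor and gains decay in `m`. -/
theorem sobWeight_rpow_mul_le (hs : 0 ≤ s) (hr : s ≤ r) (k : Fin d → ℤ) (m : ℤ) :
    sobWeight k ^ (s / 2)
      ≤ (1 + (m : ℝ) ^ 2) ^ (-((r - s) / 2))
        * sobWeight (Fin.snoc k m : Fin (d + 1) → ℤ) ^ (r / 2) := by
  have h1 := sobWeight_pos k
  have h2 := one_le_sobWeight k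
  have h3 : (0 : ℝ) < 1 + (m : ℝ) ^ 2 := by positivity
  have h4 := sobWeight_pos (Fin.snoc k m : Fin (d + 1) → ℤ)
  rw [Real.rpow_neg h3.le, ← div_eq_inv_mul, le_div_iff₀ (by positivity),
    show r / 2 = s / 2 + (r - s) / 2 by ring, Real.rpow_add h4]
  rw [sobWeight_snoc] at h4 ⊢
  refine mul_le_mul ?_ ?_ (by positivity) (by positivity)
  · exact Real.rpow_le_rpow h1.le (by nlinarith) (by linarith)
  · exact Real.rpow_le_rpow h3.le (by linarith) (by linarith)

/-- The constant in the trace estimate. -/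
def traceConst (r s : ℝ) : ℝ := ∑' m : ℤ, (1 + (m : ℝ) ^ 2) ^ (-(r - s))

theorem traceConst_nonneg (r s : ℝ) : 0 ≤ traceConst r s :=
  tsum_nonneg fun m => by positivity

/-- The trace estimate for restrictions to a hyperplane, in terms of Fourier coefficients. -/
theorem trace_estimate (hs : 0 ≤ s) (hr : s + 1 / 2 < r) {a : (Fin (d + 1) → ℤ) → ℂ}
    (ha : Summable fun κ => (sobWeight κ ^ (r / 2) * ‖a κ‖) ^ 2) (p : UnitAddCircle) :
    (∀ k : Fin d → ℤ, Summable fun m : ℤ => a (Fin.snoc k m) * fourier m p) ∧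
    Summable (fun k : Fin d → ℤ =>
      (sobWeight k ^ (s / 2) * ‖∑' m : ℤ, a (Fin.snoc k m) * fourier m p‖) ^ 2) ∧
    ∑' k : Fin d → ℤ, (sobWeight k ^ (s / 2) * ‖∑' m : ℤ, a (Fin.snoc k m) * fourier m p‖) ^ 2
      ≤ traceConst r s * ∑' κ, (sobWeight κ ^ (r / 2) * ‖a κ‖) ^ 2 := by
  let y : (Fin (d + 1) → ℤ) → ℝ := fun κ => sobWeight κ ^ (r / 2) * ‖a κ‖
  have hy0 : ∀ κ, 0 ≤ y κ := fun κ =>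
    mul_nonneg (Real.rpow_nonneg (sobWeight_pos κ).le _) (norm_nonneg _)
  let e : (Fin d → ℤ) × ℤ ≃ (Fin (d + 1) → ℤ) :=
    (Equiv.prodComm _ _).trans (Fin.snocEquiv fun _ => ℤ)
  have he : ∀ k m, e (k, m) = Fin.snoc k m := fun k m => rfl
  have hsum : Summable fun q : (Fin d → ℤ) × ℤ => y (e q) ^ 2 := e.summable_iff.2 ha
  have hfac : ∀ k, Summable fun m : ℤ => y (Fin.snoc k m) ^ 2 := fun k => hsum.prod_factor k
  have htot : ∑' κ, y κ ^ 2 = ∑' k, ∑' m : ℤ, y (Fin.snoc k m) ^ 2 := by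
    rw [← e.tsum_eq, hsum.tsum_prod]
    rfl
  -- The Cauchy–Schwarz weight in the last frequency; its square is summable precisely because `r -
  -- s > 1/2`, and the sum is `traceConst r s`.
  let u : ℤ → ℝ := fun m => (1 + (m : ℝ) ^ 2) ^ (-((r - s) / 2))
  have hu0 : ∀ m, 0 ≤ u m := fun m => by positivity
  have hu2 : ∀ m, u m ^ 2 = (1 + (m : ℝ) ^ 2) ^ (-(r - s)) := by
    intro m
    rw [← Real.rpow_natCast, ← Real.rpow_mul (by positivity)]
    congr 1
    push_cast
    ring
  have husum : Summable fun m => u m ^ 2 := by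
    simp_rw [hu2]
    exact summable_one_add_sq_rpow (by linarith)
  have hterm : ∀ k m, sobWeight k ^ (s / 2) * ‖a (Fin.snoc k m) * fourier m p‖
      ≤ u m * y (Fin.snoc k m) := by
    intro k m
    have hf : ‖(fourier m p : ℂ)‖ = 1 := by
      rw [fourier_apply]
      exact Circle.norm_coe _
    rw [norm_mul, hf, mul_one, ← mul_assoc]
    exact mul_le_mul_of_nonneg_right (sobWeight_rpow_mul_le hs (by linarith) k m) (norm_nonneg _)
  have hCS : ∀ k, (Summable fun m => u m * y (Fin.snoc k m)) ∧
      ∑' m, u m * y (Fin.snoc k m)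
        ≤ (∑' m, u m ^ 2) ^ (1 / (2 : ℝ)) * (∑' m : ℤ, y (Fin.snoc k m) ^ 2) ^ (1 / (2 : ℝ)) := by
    intro k
    have h1 := Real.summable_mul_of_Lp_Lq_of_nonneg (p := 2) (q := 2)
      Real.HolderConjugate.two_two hu0 (fun m => hy0 (Fin.snoc k m))
      (by simpa using husum) (by simpa using hfac k)
    have h2 := Real.inner_le_Lp_mul_Lq_tsum_of_nonneg (p := 2) (q := 2)
      Real.HolderConjugate.two_two hu0 (fun m => hy0 (Fin.snoc k m))
      (by simpa using husum) (by simpa using hfac k)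
    exact ⟨h1, by simpa using h2⟩
  have hnorm : ∀ k, Summable fun m : ℤ => ‖a (Fin.snoc k m) * fourier m p‖ := by
    intro k
    have hw : 0 < sobWeight k ^ (s / 2) := Real.rpow_pos_of_pos (sobWeight_pos k) _
    refine (summable_mul_left_iff hw.ne').1 ?_
    exact Summable.of_nonneg_of_le (fun m => by positivity) (hterm k) (hCS k).1
  have hle : ∀ k, (sobWeight k ^ (s / 2) * ‖∑' m : ℤ, a (Fin.snoc k m) * fourier m p‖) ^ 2
      ≤ traceConst r s * ∑' m : ℤ, y (Fin.snoc k m) ^ 2 := by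
    intro k
    have hw : 0 < sobWeight k ^ (s / 2) := Real.rpow_pos_of_pos (sobWeight_pos k) _
    have h1 : sobWeight k ^ (s / 2) * ‖∑' m : ℤ, a (Fin.snoc k m) * fourier m p‖
        ≤ ∑' m, u m * y (Fin.snoc k m) := by
      refine (mul_le_mul_of_nonneg_left (norm_tsum_le_tsum_norm (hnorm k)) hw.le).trans ?_
      rw [← tsum_mul_left]
      exact ((hnorm k).mul_left _).tsum_le_tsum (hterm k) (hCS k).1
    have h2 := h1.trans (hCS k).2
    have hA : 0 ≤ ∑' m, u m ^ 2 := tsum_nonneg fun _ => by positivity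
    have hB : 0 ≤ ∑' m : ℤ, y (Fin.snoc k m) ^ 2 := tsum_nonneg fun _ => by positivity
    have h3 := pow_le_pow_left₀ (by positivity) h2 2
    rw [← Real.sqrt_eq_rpow, ← Real.sqrt_eq_rpow, mul_pow (√_), Real.sq_sqrt hA,
      Real.sq_sqrt hB] at h3
    simpa only [hu2, traceConst] using h3
  have hs2 : Summable fun k => traceConst r s * ∑' m : ℤ, y (Fin.snoc k m) ^ 2 :=
    hsum.prod.mul_left _
  have hs1 := Summable.of_nonneg_of_le (fun k => by positivity) hle hs2
  refine ⟨fun k => (hnorm k).of_norm, hs1, ?_⟩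
  change _ ≤ _ * ∑' κ, y κ ^ 2
  rw [htot, ← tsum_mul_left]
  exact hs1.tsum_le_tsum hle hs2

variable [NeZero n]

theorem Sob.summable_weighted_sq {ι : Type} [Fintype ι] (v : Sob d s ι) :
    Summable fun k => ‖v.weighted k‖ ^ 2 := by
  have := (lp.memℓp v.weighted).summable (by norm_num)
  simpa using this

theorem norm_sobWeight_smul {E : Type*} [NormedAddCommGroup E] [NormedSpace ℂ E]
    (k : Fin d → ℤ) (q : ℝ) (z : E) :
    ‖((sobWeight k ^ q : ℝ) : ℂ) • z‖ = sobWeight k ^ q * ‖z‖ := by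
  rw [norm_smul, Complex.norm_real, Real.norm_of_nonneg (Real.rpow_nonneg (sobWeight_pos k).le _)]

theorem norm_unit (z : EuclideanSpace ℂ Unit) : ‖z‖ = ‖z ()‖ := by
  rw [EuclideanSpace.norm_eq]
  simp

theorem IsSampling.unique {p : ZMod n → UnitAddCircle} {v : Sob (d + 1) r Unit}
    {v₁ v₂ : Sob d s (ZMod n)} (h₁ : IsSampling p v v₁) (h₂ : IsSampling p v v₂) : v₁ = v₂ := by
  refine Sob.ext_coeff fun k => ?_
  ext j
  exact (h₁ k j).unique (h₂ k j)

/-- The slice is built from its prescribed coefficients. The trace estimate gives their weighted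
summability, `s ≥ 0` gives plain square summability, and the symmetry under `(k, m) ↦ (-k, -m)`
makes the function real. -/
theorem exists_isSampling (hs : 0 ≤ s) (hr : s + 1 / 2 < r) (p : ZMod n → UnitAddCircle)
    (v : Sob (d + 1) r Unit) : ∃ v' : Sob d s (ZMod n), IsSampling p v v' := by
  let a : (Fin (d + 1) → ℤ) → ℂ := fun κ => coeff v.toL2 κ ()
  have ha : Summable fun κ => (sobWeight κ ^ (r / 2) * ‖a κ‖) ^ 2 := by
    convert v.summable_weighted_sq using 3 with κ
    rw [Sob.weighted_apply, norm_sobWeight_smul, norm_unit]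
  let b : (Fin d → ℤ) → EuclideanSpace ℂ (ZMod n) := fun k =>
    WithLp.toLp 2 fun j => ∑' m : ℤ, a (Fin.snoc k m) * fourier m (p j)
  have hb : Summable fun k => (sobWeight k ^ (s / 2) * ‖b k‖) ^ 2 := by
    simp_rw [mul_pow, EuclideanSpace.norm_sq_eq, Finset.mul_sum, ← mul_pow]
    exact summable_sum fun j _ => (trace_estimate hs hr ha (p j)).2.1
  have hb' : Summable fun k => ‖b k‖ ^ 2 := by
    refine Summable.of_nonneg_of_le (fun k => by positivity) (fun k => ?_) hb
    refine pow_le_pow_left₀ (norm_nonneg _) ?_ 2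
    exact le_mul_of_one_le_left (norm_nonneg _)
      (Real.one_le_rpow (one_le_sobWeight k) (by linarith))
  have hherm : ∀ k j, b (-k) j = (starRingEnd ℂ) (b k j) := by
    intro k j
    change ∑' m : ℤ, a (Fin.snoc (-k) m) * fourier m (p j)
      = (starRingEnd ℂ) (∑' m : ℤ, a (Fin.snoc k m) * fourier m (p j))
    rw [Complex.conj_tsum, ← (Equiv.neg ℤ).tsum_eq]
    congr 1
    funext m
    have h1 : (Fin.snoc (-k) (-m) : Fin (d + 1) → ℤ) = -(Fin.snoc k m) := by
      funext i
      refine Fin.lastCases ?_ (fun i => ?_) i <;> simp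
    simp only [Equiv.neg_apply, h1, a, coeff_neg_apply, map_mul, fourier_neg]
  obtain ⟨w, hw⟩ := exists_coeff_eq b hb' hherm
  refine ⟨⟨w, ?_⟩, fun k j => ?_⟩
  · refine memℓp_gen ?_
    convert hb using 2 with k
    rw [hw, norm_sobWeight_smul]
    simp
  · change HasSum _ (coeff w k j)
    rw [hw]
    exact ((trace_estimate hs hr ha (p j)).1 k).hasSum

/-- The trace estimate for the difference of coefficients, added over the `n` grid points. -/
theorem dist_le_of_isSampling (hs : 0 ≤ s) (hr : s + 1 / 2 < r) {p : ZMod n → UnitAddCircle}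
    {u v : Sob (d + 1) r Unit} {u' v' : Sob d s (ZMod n)} (hu : IsSampling p u u')
    (hv : IsSampling p v v') : dist u' v' ≤ √(n * traceConst r s) * dist u v := by
  let a : (Fin (d + 1) → ℤ) → ℂ := fun κ => coeff u.toL2 κ () - coeff v.toL2 κ ()
  have hw : ∀ {D : ℕ} {q : ℝ} {ι : Type} [Fintype ι] (x y : Sob D q ι) (κ : Fin D → ℤ),
      ‖(x.weighted - y.weighted) κ‖
        = sobWeight κ ^ (q / 2) * ‖coeff x.toL2 κ - coeff y.toL2 κ‖ := by
    intro D q ι _ x y κ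
    rw [← norm_sobWeight_smul, smul_sub]
    rfl
  have hd : ∀ {D : ℕ} {q : ℝ} {ι : Type} [Fintype ι] (x y : Sob D q ι),
      HasSum (fun κ => (sobWeight κ ^ (q / 2) * ‖coeff x.toL2 κ - coeff y.toL2 κ‖) ^ 2)
        (dist x y ^ 2) := by
    intro D q ι _ x y
    have h := lp.hasSum_norm (p := 2) (by norm_num) (x.weighted - y.weighted)
    rw [Sob.dist_eq]
    simp only [hw] at h
    simpa using h
  have h1 := hd u v
  have h1' : (fun κ => (sobWeight κ ^ (r / 2) * ‖coeff u.toL2 κ - coeff v.toL2 κ‖) ^ 2)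
      = fun κ => (sobWeight κ ^ (r / 2) * ‖a κ‖) ^ 2 := by
    funext κ
    rw [norm_unit]
    rfl
  rw [h1'] at h1
  have h2 := hd u' v'
  have h3 : ∀ j, ∀ k, (coeff u'.toL2 k - coeff v'.toL2 k) j
      = ∑' m : ℤ, a (Fin.snoc k m) * fourier m (p j) := by
    intro j k
    have := (hu k j).sub (hv k j)
    simp only [← sub_mul] at this
    exact this.tsum_eq.symm
  have h4 : HasSum (fun k => (sobWeight k ^ (s / 2) * ‖coeff u'.toL2 k - coeff v'.toL2 k‖) ^ 2)
      (∑ j, ∑' k, (sobWeight k ^ (s / 2)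
        * ‖∑' m : ℤ, a (Fin.snoc k m) * fourier m (p j)‖) ^ 2) := by
    simp_rw [mul_pow, EuclideanSpace.norm_sq_eq, Finset.mul_sum, h3, ← mul_pow]
    exact hasSum_sum fun j _ => (trace_estimate hs hr h1.summable (p j)).2.1.hasSum
  refine le_of_sq_le_sq ?_ (by positivity)
  rw [h2.unique h4, mul_pow, Real.sq_sqrt (mul_nonneg (Nat.cast_nonneg n) (traceConst_nonneg r s)),
    mul_assoc, ← h1.tsum_eq]
  refine (Finset.sum_le_card_nsmul _ _ _ fun j _ =>
    (trace_estimate hs hr h1.summable (p j)).2.2).trans ?_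
  rw [nsmul_eq_mul, Finset.card_univ, ZMod.card]

theorem isCompact_samplings (hs : 0 ≤ s) (hr : s + 1 / 2 < r) (p : ZMod n → UnitAddCircle)
    {𝒱 : Set (Sob (d + 1) r Unit)} (h𝒱 : IsCompact 𝒱) :
    IsCompact {v' : Sob d s (ZMod n) | ∃ v ∈ 𝒱, IsSampling p v v'} := by
  choose S hS using fun v : Sob (d + 1) r Unit => exists_isSampling (s := s) hs hr p v
  have hcont : Continuous S :=
    (LipschitzWith.of_dist_le_mul (K := ⟨√(n * traceConst r s), Real.sqrt_nonneg _⟩)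
      fun u v => dist_le_of_isSampling hs hr (hS u) (hS v)).continuous
  have : {v' : Sob d s (ZMod n) | ∃ v ∈ 𝒱, IsSampling p v v'} = S '' 𝒱 := by
    ext v'
    constructor
    · rintro ⟨v, hv, h⟩
      exact ⟨v, hv, (hS v).unique h⟩
    · rintro ⟨v, hv, rfl⟩
      exact ⟨v, hv, hS v⟩
  rw [this]
  exact h𝒱.image hcont

end

section

variable {d K n : ℕ} {s : ℝ} {ι κ μ : Type}

/-! ### Approximation of operators through approximation of conjugate maps -/

section Classes

variable [Fintype ι]

theorem norm_projL2_sub_coeffOp (M : Sob d s ι → L2 d ι) {Φ : Coeff d K ι → Coeff d K ι}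
    (v : Sob d s ι) (hΦ : IsHermitian (Φ (spec K v))) :
    ‖projL2 K (M (proj K v)) - coeffOp Φ v‖ = ‖conjMap K M (spec K v) - Φ (spec K v)‖ := by
  rw [projL2_proj_eq, coeffOp, norm_synth_sub _ _ (isHermitian_conjMap _ _) hΦ]

/-- Both directions compare with the truncated operator: its distance to `M` is eventually below `ε
/ 2` uniformly on `V`, and its distance to `coeffOp Φ` is exactly the coefficient error, thanks to
the Hermitian values of `Φ`. -/
theorem approx_iff_conjMap_approx {V : Set (Sob d s ι)} (hV : IsCompact V)
    {M : Sob d s ι → L2 d ι} (hM : Continuous M) (𝒞 : ∀ K : ℕ, Set (Coeff d K ι → Coeff d K ι))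
    (h𝒞 : ∀ K, ∀ Φ ∈ 𝒞 K, ∀ c ∈ spec K '' V, IsHermitian (Φ c)) :
    (∀ ε > 0, ∃ K₀, ∀ K ≥ K₀, ∃ Φ ∈ 𝒞 K, ∀ v ∈ V, ‖M v - coeffOp Φ v‖ ≤ ε) ↔
      ∀ ε > 0, ∃ K₀, ∀ K ≥ K₀, ∃ Φ ∈ 𝒞 K, ∀ c ∈ spec K '' V, ‖conjMap K M c - Φ c‖ ≤ ε := by
  have hlim : ∀ ε > 0, ∃ K₀, ∀ K ≥ K₀, ∀ v ∈ V, ‖M v - projL2 K (M (proj K v))‖ < ε := by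
    intro ε hε
    have h := Metric.tendstoUniformlyOn_iff.1 (tendstoUniformlyOn_projL2_proj hV hM) ε hε
    simpa only [eventually_atTop, dist_eq_norm] using h
  constructor
  · intro h ε hε
    obtain ⟨K₁, h₁⟩ := hlim (ε / 2) (half_pos hε)
    obtain ⟨K₂, h₂⟩ := h (ε / 2) (half_pos hε)
    refine ⟨max K₁ K₂, fun K hK => ?_⟩
    obtain ⟨Φ, hΦ, hv⟩ := h₂ K (le_of_max_le_right hK)
    refine ⟨Φ, hΦ, ?_⟩
    rintro _ ⟨v, hvV, rfl⟩
    rw [← norm_projL2_sub_coeffOp M v (h𝒞 K Φ hΦ _ ⟨v, hvV, rfl⟩)]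
    have h3 := norm_sub_le_norm_sub_add_norm_sub (projL2 K (M (proj K v))) (M v) (coeffOp Φ v)
    rw [norm_sub_rev (projL2 K (M (proj K v))) (M v)] at h3
    linarith [hv v hvV, h₁ K (le_of_max_le_left hK) v hvV]
  · intro h ε hε
    obtain ⟨K₁, h₁⟩ := hlim (ε / 2) (half_pos hε)
    obtain ⟨K₂, h₂⟩ := h (ε / 2) (half_pos hε)
    refine ⟨max K₁ K₂, fun K hK => ?_⟩
    obtain ⟨Φ, hΦ, hv⟩ := h₂ K (le_of_max_le_right hK)
    refine ⟨Φ, hΦ, fun v hvV => ?_⟩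
    have h2 := hv _ ⟨v, hvV, rfl⟩
    rw [← norm_projL2_sub_coeffOp M v (h𝒞 K Φ hΦ _ ⟨v, hvV, rfl⟩)] at h2
    have h3 := norm_sub_le_norm_sub_add_norm_sub (M v) (projL2 K (M (proj K v))) (coeffOp Φ v)
    linarith [h₁ K (le_of_max_le_left hK) v hvV]

theorem conjMap_approx_iff_conjMapP_approx [NeZero n] {V : Set (Sob d s (ZMod n))}
    {M : Sob d s (ZMod n) → L2 d (ZMod n)}
    (𝒞 : ∀ K : ℕ, Set (Coeff d K (ZMod n) → Coeff d K (ZMod n))) :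
    (∀ ε > 0, ∃ K₀, ∀ K ≥ K₀, ∃ Φ ∈ 𝒞 K, ∀ c ∈ spec K '' V, ‖conjMap K M c - Φ c‖ ≤ ε) ↔
      ∀ ε > 0, ∃ K₀, ∀ K ≥ K₀, ∃ Φ ∈ 𝒞 K, ∀ c ∈ (fun v => pDFT (spec K v)) '' V,
        ‖conjMapP K M c - pDFT (Φ (pDFTInv c))‖ ≤ ε := by
  have hn := sqrt_natCast_pos n
  simp only [Set.forall_mem_image, conjMapP_pDFT, pDFTInv_pDFT, ← pDFT_sub, norm_pDFT]
  constructor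
  · intro h ε hε
    obtain ⟨K₀, h₀⟩ := h (ε / √n) (by positivity)
    refine ⟨K₀, fun K hK => ?_⟩
    obtain ⟨Φ, hΦ, hv⟩ := h₀ K hK
    exact ⟨Φ, hΦ, fun v hvV => (le_div_iff₀' hn).1 (hv hvV)⟩
  · intro h ε hε
    obtain ⟨K₀, h₀⟩ := h (√n * ε) (by positivity)
    refine ⟨K₀, fun K hK => ?_⟩
    obtain ⟨Φ, hΦ, hv⟩ := h₀ K hK
    exact ⟨Φ, hΦ, fun v hvV => le_of_mul_le_mul_left (hv hvV) hn⟩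

end Classes

/-! ### Networks acting mode by mode -/

/-- Networks for the single modes give an approximation of the synthesised operator. -/
theorem NN.exists_modewise_approx {σ : ℝ → ℝ} (hc : Continuous σ)
    (hσ : ¬ ∃ q : Polynomial ℝ, ∀ x, σ x = q.eval x) [Fintype ι]
    {X : Type} [TopologicalSpace X] {V : Set X} (hV : IsCompact V)
    {p : X → Coeff d K ι} (hp : Continuous p) {q : X → Coeff d K ι} (hq : Continuous q)
    {m : Modes d K → EuclideanSpace ℂ ι → EuclideanSpace ℂ ι}
    (hm : ∀ v ∈ V, ∀ i, q v i = m i (p v i)) (L : Coeff d K ι →ₗ[ℝ] L2 d ι) {ε : ℝ} (hε : 0 < ε) :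
    ∃ Φ : Modes d K → NN (ι × Bool) (ι × Bool),
      (∀ i, ∀ z ∈ (fun v => p v i) '' V,
        ‖complexify ((Φ i).eval σ (realify z)) - m i z‖ ≤ ε) ∧
      ∀ v ∈ V, ‖L (q v) - L (WithLp.toLp 2 fun i =>
        complexify ((Φ i).eval σ (realify (p v i))))‖ ≤ ε := by
  obtain ⟨B, hB, hLB⟩ := (LinearMap.toContinuousLinearMap L).bound
  -- The error of all modes together is at most the number of modes times `δ`, and `L` enlarges it
  -- by at most `B`.
  let δ : ℝ := min ε (ε / (B * (Fintype.card (Modes d K) + 1)))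
  have hδ : 0 < δ := by positivity
  have hex : ∀ i, ∃ Φ : NN (ι × Bool) (ι × Bool), ∀ z ∈ (fun v => p v i) '' V,
      ‖complexify (Φ.eval σ (realify z)) - m i z‖ ≤ δ := by
    intro i
    have hpi : Continuous fun v => p v i := (PiLp.continuous_apply 2 _ i).comp hp
    refine NN.exists_complexify_approx hc hσ (hV.image hpi) ?_ hδ
    -- No continuity of `m i` is assumed; on the compact set of its mode it is inherited from `q`,
    -- which factors through it.
    exact continuousOn_image_of_comp hV hpi ((PiLp.continuous_apply 2 _ i).comp hq)
      fun v hv => hm v hv i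
  choose Φ hΦ using hex
  refine ⟨Φ, fun i z hz => (hΦ i z hz).trans (min_le_left _ _), fun v hv => ?_⟩
  rw [← map_sub]
  refine (hLB _).trans ?_
  have h1 : ‖q v - WithLp.toLp 2 fun i => complexify ((Φ i).eval σ (realify (p v i)))‖
      ≤ Fintype.card (Modes d K) * δ := by
    refine piLp_norm_le_card_mul _ fun i => ?_
    rw [PiLp.sub_apply, hm v hv i, norm_sub_rev]
    exact hΦ i _ ⟨v, hv, rfl⟩
  refine (mul_le_mul_of_nonneg_left h1 hB.le).trans ?_
  have h2 : δ * (B * (Fintype.card (Modes d K) + 1)) ≤ ε := by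
    rw [← le_div_iff₀ (by positivity)]
    exact min_le_right _ _
  nlinarith [mul_pos hB hδ]

/-! ### Composition -/

theorem NeuralOp.app_comp (σ : ℝ → ℝ) (arch : Arch) (N : NeuralOp d ι κ) (N' : NeuralOp d κ μ)
    (f : Torus d → EuclideanSpace ℝ ι) :
    (N.comp N').app σ arch f = N'.app σ arch (N.app σ arch f) := by
  funext x
  simp only [NeuralOp.app, NeuralOp.eval]

/-- A crude uniform bound valid for all coefficients: outputs of networks need not be Hermitian, so
the isometry is not available for them. -/
theorem norm_synthFun_le [Fintype ι] (c : Coeff d K ι) (x : Torus d) :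
    ‖synthFun c x‖ ≤ Fintype.card ι * (Fintype.card (Modes d K) * ‖c‖) := by
  refine norm_le_card_mul _ fun j => ?_
  refine (Complex.abs_re_le_norm _).trans ((norm_sum_le _ _).trans ?_)
  refine (Finset.sum_le_card_nsmul _ _ ‖c‖ fun i _ => ?_).trans ?_
  · rw [norm_mul, norm_mFourier_apply, mul_one]
    exact (PiLp.norm_apply_le (c i) j).trans (PiLp.norm_apply_le c i)
  · rw [nsmul_eq_mul, Finset.card_univ]

theorem synthFun_sub [Fintype ι] (a b : Coeff d K ι) (x : Torus d) :
    synthFun (a - b) x = synthFun a x - synthFun b x := by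
  ext j
  simp [synthFun, sub_mul]

theorem Sob.norm_toL2_le [Fintype ι] (hs : 0 ≤ s) (v : Sob d s ι) : ‖v.toL2‖ ≤ ‖v.weighted‖ := by
  have h1 := hasSum_norm_sq_coeff v.toL2
  have h2 : HasSum (fun k => ‖v.weighted k‖ ^ 2) (‖v.weighted‖ ^ 2) := by
    have := lp.hasSum_norm (p := 2) (by norm_num) v.weighted
    simpa using this
  refine le_of_sq_le_sq ?_ (norm_nonneg _)
  refine hasSum_le (fun k => ?_) h1 h2
  refine pow_le_pow_left₀ (norm_nonneg _) ?_ 2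
  rw [Sob.weighted_apply, norm_sobWeight_smul]
  exact le_mul_of_one_le_left (norm_nonneg _)
    (Real.one_le_rpow (one_le_sobWeight k) (by linarith))

/-- An approximate forward transform, a network for the map of coefficients and an approximate
inverse transform compose to an approximation of the composition. -/
theorem NeuralOp.exists_approx_comp {σ : ℝ → ℝ} (hc : Continuous σ)
    (hσ : ¬ ∃ q : Polynomial ℝ, ∀ x, σ x = q.eval x) (arch : Arch) [Fintype ι] (hs : 0 ≤ s)
    {V : Set (Sob d s ι)} (hV : IsCompact V) {T T' Q : Coeff d K ι → Coeff d K ι}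
    (hT : Continuous T) (hT' : Continuous T') (hQ : Continuous Q) {ε : ℝ} (hε : 0 < ε) :
    ∃ (F : NeuralOp d ι ((Modes d K × ι) × Bool))
      (Φ : NN ((Modes d K × ι) × Bool) ((Modes d K × ι) × Bool))
      (G : NeuralOp d ((Modes d K × ι) × Bool) ι),
      (∀ v ∈ V, ∃ y, (∀ x, F.app σ arch v.toL2 x = y) ∧ ‖y - enc (T (spec K v))‖ ≤ ε) ∧
      (∀ c ∈ (fun v => T (spec K v)) '' V, ‖Φ.eval σ (enc c) - enc (Q c)‖ ≤ ε) ∧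
      (∀ c ∈ Q '' ((fun v => T (spec K v)) '' V), ∀ x,
        ‖G.app σ arch (fun _ => enc c) x - synthFun (T' c) x‖ ≤ ε) ∧
      ∀ v ∈ V, ∀ x, ‖(F.comp ((Φ.toOp d).comp G)).app σ arch v.toL2 x
        - synthFun (T' (Q (T (spec K v)))) x‖ ≤ ε := by
  have hC : IsCompact ((fun v => T (spec K v)) '' V) := hV.image (hT.comp continuous_spec)
  set C := (fun v => T (spec K v)) '' V
  obtain ⟨R, hR⟩ := (hC.image hQ).isBounded.exists_norm_le
  obtain ⟨R₁, hR₁⟩ := hC.isBounded.exists_norm_le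
  obtain ⟨R₂, hR₂⟩ := (hV.image (Sob.continuous_weighted (s := s))).isBounded.exists_norm_le
  -- The factors are chosen from the outside in: each must tolerate the error of the one applied
  -- before it. So `G` and the modulus `η` of `T'` come first, then `Φ` and its modulus `δ`, and `F`
  -- last.
  obtain ⟨G, hG⟩ := NeuralOp.exists_approx_inverse hc hσ arch hT' (R + 1)
    (show 0 < ε / 3 by positivity)
  -- The constant of `norm_synthFun_le`, increased by `1` to be positive.
  let B : ℝ := Fintype.card ι * Fintype.card (Modes d K) + 1
  have hB : 0 < B := by positivity
  obtain ⟨η, hη, hηT⟩ := Metric.uniformContinuousOn_iff.1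
    ((isCompact_closedBall (0 : Coeff d K ι) (R + 1)).uniformContinuousOn_of_continuous
      hT'.continuousOn) (ε / 3 / B) (by positivity)
  have hη' : 0 < min η 1 := by positivity
  obtain ⟨Φ, hΦ⟩ := NN.exists_enc_approx hc hσ hC (continuous_enc.comp hQ)
    (show 0 < min ε (min η 1 / 3) by positivity)
  obtain ⟨δ, hδ, hδΦ⟩ := Metric.uniformContinuousOn_iff.1
    ((isCompact_closedBall (0 : EuclideanSpace ℝ ((Modes d K × ι) × Bool))
      (R₁ + 1)).uniformContinuousOn_of_continuous (NN.continuous_eval hc Φ).continuousOn)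
    (min η 1 / 3) (by positivity)
  obtain ⟨F, hF⟩ := NeuralOp.exists_approx_forward (d := d) (K := K) (ι := ι) hc hσ arch
    (τ := fun y => enc (T (dec ι y))) (continuous_enc.comp (hT.comp continuous_dec)) R₂
    (show 0 < min ε (min (δ / 2) 1) by positivity)
  have hF' : ∀ v ∈ V, ∃ y, (∀ x, F.app σ arch v.toL2 x = y) ∧
      ‖y - enc (T (spec K v))‖ ≤ min ε (min (δ / 2) 1) := by
    intro v hv
    have := hF v.toL2 ((Sob.norm_toL2_le hs v).trans (hR₂ _ ⟨v, hv, rfl⟩))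
    simpa only [dec_enc, ← spec_eq] using this
  refine ⟨F, Φ, G, fun v hv => ?_, fun c hcC => (hΦ c hcC).trans (min_le_left _ _),
    fun c hcC x => ?_, fun v hv x => ?_⟩
  · obtain ⟨y, hy, hy'⟩ := hF' v hv
    exact ⟨y, hy, hy'.trans (min_le_left _ _)⟩
  · refine (hG c ((hR c hcC).trans (by linarith)) x).trans (by linarith)
  · obtain ⟨y, hy, hy'⟩ := hF' v hv
    set c := T (spec K v)
    have hcC : c ∈ C := ⟨v, hv, rfl⟩
    have happ : (F.comp ((Φ.toOp d).comp G)).app σ arch v.toL2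
        = G.app σ arch fun _ => Φ.eval σ y := by
      rw [NeuralOp.app_comp, NeuralOp.app_comp]
      congr 1
      funext x
      rw [NN.toOp_app, hy]
    have hy2 : ‖y - enc c‖ ≤ min (δ / 2) 1 := hy'.trans (min_le_right _ _)
    have hcR : ‖enc c‖ ≤ R₁ := by
      rw [norm_enc]
      exact hR₁ c hcC
    have h1 : ‖Φ.eval σ y - Φ.eval σ (enc c)‖ < min η 1 / 3 := by
      rw [← dist_eq_norm]
      refine hδΦ y ?_ _ ?_ ?_
      · rw [mem_closedBall_zero_iff]
        have := norm_le_norm_add_norm_sub' y (enc c)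
        have := hy2.trans (min_le_right _ _)
        linarith
      · rw [mem_closedBall_zero_iff]
        linarith
      · rw [dist_eq_norm]
        exact (hy2.trans (min_le_left _ _)).trans_lt (half_lt_self hδ)
    have h2 : ‖Φ.eval σ (enc c) - enc (Q c)‖ ≤ min η 1 / 3 := (hΦ c hcC).trans (min_le_right _ _)
    -- The intermediate network output is a constant, so it can be read as coefficients `c'` near `Q
    -- c`, to which the guarantee for `G` applies inside the enlarged ball.
    let c' : Coeff d K ι := dec ι (Φ.eval σ y)
    have hc' : enc c' = Φ.eval σ y := enc_dec _
    have h3 : ‖c' - Q c‖ < min η 1 := by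
      rw [← norm_enc, enc_sub, hc']
      have := norm_sub_le_norm_sub_add_norm_sub (Φ.eval σ y) (Φ.eval σ (enc c)) (enc (Q c))
      linarith
    have hQR : ‖Q c‖ ≤ R := hR _ ⟨c, hcC, rfl⟩
    have hcR' : ‖c'‖ ≤ R + 1 := by
      have := norm_le_norm_add_norm_sub' c' (Q c)
      have := h3.trans_le (min_le_right η 1)
      linarith
    have h4 := hG c' hcR' x
    rw [hc', ← happ] at h4
    have h5 : ‖synthFun (T' c') x - synthFun (T' (Q c)) x‖ ≤ ε / 3 := by
      have h6 := hηT c' (mem_closedBall_zero_iff.2 hcR') (Q c)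
        (mem_closedBall_zero_iff.2 (by linarith)) (by
          rw [dist_eq_norm]
          exact h3.trans_le (min_le_left _ _))
      rw [dist_eq_norm, lt_div_iff₀ hB] at h6
      rw [← synthFun_sub]
      refine (norm_synthFun_le _ x).trans ?_
      simp only [B] at h6
      nlinarith [norm_nonneg (T' c' - T' (Q c))]
    have h7 := norm_sub_le_norm_sub_add_norm_sub
      ((F.comp ((Φ.toOp d).comp G)).app σ arch v.toL2 x) (synthFun (T' c') x)
      (synthFun (T' (Q c)) x)
    linarith

/-- On a probability space a uniform error `a` is at most `a` in `L²`. The triangle inequality is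
applied to the pointwise majorant, so `f` need not be measurable. -/
theorem eLpNorm_le_of_norm_sub_synthFun_le [Fintype ι] {f : Torus d → EuclideanSpace ℝ ι}
    {c : Coeff d K ι} {w : L2 d ι} {a b : ℝ} (ha : 0 ≤ a) (hf : ∀ x, ‖f x - synthFun c x‖ ≤ a)
    (hw : ‖synth c - w‖ ≤ b) :
    eLpNorm (fun x => f x - w x) 2 (haarT d) ≤ ENNReal.ofReal (a + b) := by
  have hb : 0 ≤ b := (norm_nonneg _).trans hw
  have h1 : eLpNorm (fun x => f x - w x) 2 (haarT d)
      ≤ eLpNorm (fun x => a + ‖(synth c - w : L2 d ι) x‖) 2 (haarT d) := by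
    refine eLpNorm_mono_ae_real ?_
    filter_upwards [coeFn_synth c, Lp.coeFn_sub (synth c) w] with x h1 h2
    rw [h2, Pi.sub_apply, h1]
    exact (norm_sub_le_norm_sub_add_norm_sub (f x) (synthFun c x) (w x)).trans
      (add_le_add_left (hf x) _)
  have h2 : eLpNorm (fun x => a + ‖(synth c - w : L2 d ι) x‖) 2 (haarT d)
      ≤ eLpNorm (fun _ => a) 2 (haarT d)
        + eLpNorm (fun x => ‖(synth c - w : L2 d ι) x‖) 2 (haarT d) :=
    eLpNorm_add_le aestronglyMeasurable_const (Lp.aestronglyMeasurable _).norm (by norm_num)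
  refine h1.trans (h2.trans ?_)
  rw [eLpNorm_norm, ENNReal.ofReal_add ha hb]
  refine add_le_add ?_ ?_
  · rw [eLpNorm_const _ (by norm_num) (IsProbabilityMeasure.ne_zero _), measure_univ,
      ENNReal.one_rpow, mul_one, Real.enorm_of_nonneg ha]
  · rw [← Lp.enorm_def, ← ofReal_norm]
    exact ENNReal.ofReal_le_ofReal hw

theorem eLpNorm_sub_synth_le [Fintype ι] {f : Torus d → EuclideanSpace ℝ ι}
    {c : Coeff d K ι} {a : ℝ} (ha : 0 ≤ a) (hf : ∀ x, ‖f x - synthFun c x‖ ≤ a) :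
    eLpNorm (fun x => f x - synth c x) 2 (haarT d) ≤ ENNReal.ofReal a := by
  have := eLpNorm_le_of_norm_sub_synthFun_le (w := synth c) (b := 0) ha hf (by simp)
  rwa [add_zero] at this

/-- Approximation of `M` by the composition of the three approximate factors. -/
theorem NeuralOp.exists_approx_operator {σ : ℝ → ℝ} (hc : Continuous σ)
    (hσ : ¬ ∃ q : Polynomial ℝ, ∀ x, σ x = q.eval x) (arch : Arch) [NeZero n] (hs : 0 ≤ s)
    {V : Set (Sob d s (ZMod n))} (hV : IsCompact V) {M : Sob d s (ZMod n) → L2 d (ZMod n)}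
    (hM : Continuous M) {T T' Q : ∀ K, Coeff d K (ZMod n) → Coeff d K (ZMod n)}
    (hT : ∀ K, Continuous (T K)) (hT' : ∀ K, Continuous (T' K)) (hQ : ∀ K, Continuous (Q K))
    (hTQ : ∀ K v, synth (T' K (Q K (T K (spec K v)))) = projL2 K (M (proj K v)))
    {ε : ℝ} (hε : 0 < ε) :
    ∃ K₀, ∀ K ≥ K₀,
      ∃ (F : NeuralOp d (ZMod n) ((Modes d K × ZMod n) × Bool))
        (Φ : NN ((Modes d K × ZMod n) × Bool) ((Modes d K × ZMod n) × Bool))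
        (G : NeuralOp d ((Modes d K × ZMod n) × Bool) (ZMod n)),
        ComputesCoeff σ arch F (Sob.toL2 '' V) (fun v => T K (fwd K (projL2 K v))) ε ∧
        (∀ c ∈ (fun v => T K (spec K v)) '' V, ‖Φ.eval σ (enc c) - enc (Q K c)‖ ≤ ε) ∧
        ComputesFun σ arch G (Q K '' ((fun v => T K (spec K v)) '' V))
          (fun c => synth (T' K c)) ε ∧
        ∀ v ∈ V, eLpNorm (fun x => (F.comp ((Φ.toOp d).comp G)).app σ arch v.toL2 x - M v x) 2
          (haarT d) ≤ ENNReal.ofReal ε := by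
  -- Half of `ε` pays for truncation, which fixes `K₀`; the other half is the error of the composed
  -- operator.
  have h := Metric.tendstoUniformlyOn_iff.1 (tendstoUniformlyOn_projL2_proj hV hM) (ε / 2)
    (half_pos hε)
  obtain ⟨K₀, hK₀⟩ := eventually_atTop.1 h
  refine ⟨K₀, fun K hK => ?_⟩
  obtain ⟨F, Φ, G, hF, hΦ, hG, hcomp⟩ :=
    NeuralOp.exists_approx_comp hc hσ arch hs hV (hT K) (hT' K) (hQ K) (half_pos hε)
  refine ⟨F, Φ, G, ?_, fun c hcC => (hΦ c hcC).trans (by linarith), fun c hcC => ?_,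
    fun v hv => ?_⟩
  · rintro _ ⟨v, hv, rfl⟩
    obtain ⟨y, hy, hy'⟩ := hF v hv
    refine ⟨y, ae_of_all _ hy, ?_⟩
    simp only [fwd_projL2, ← spec_eq]
    linarith
  · exact (eLpNorm_sub_synth_le (half_pos hε).le (hG c hcC)).trans
      (ENNReal.ofReal_le_ofReal (by linarith))
  · have h1 : ‖synth (T' K (Q K (T K (spec K v)))) - M v‖ ≤ ε / 2 := by
      rw [hTQ, norm_sub_rev, ← dist_eq_norm]
      exact (hK₀ K hK v hv).le
    have := eLpNorm_le_of_norm_sub_synthFun_le (half_pos hε).le (hcomp v hv) h1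
    rwa [add_halves] at this

end

end SKNO

end

/-! ### The theorem, assembled from the estimates above -/

theorem theorem1 (d n : ℕ) [NeZero n] (s : ℝ) (hs : 0 ≤ s)
    -- the compact family of lifted signals, sampled at the `n` grid points in `p`
    (V : Set (Sob d s (ZMod n))) (hV : IsCompact V)
    -- the operator to be approximated
    (M : Sob d s (ZMod n) → L2 d (ZMod n)) (hM : Continuous M)
    -- the activation function and the spectral architecture
    (σ : ℝ → ℝ) (hσL : ∃ L, LipschitzWith L σ)
    (hσ : ¬ ∃ q : Polynomial ℝ, ∀ x, σ x = q.eval x) (arch : Arch) :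
    -- sampling a compact family of functions of `(x, p)` gives a compact family of signals
    (∀ (r : ℝ), s + 1 / 2 < r → ∀ (p : ZMod n → UnitAddCircle) (𝒱 : Set (Sob (d + 1) r Unit)),
      IsCompact 𝒱 →
        (∀ v ∈ 𝒱, ∃! v' : Sob d s (ZMod n), IsSampling p v v') ∧
        IsCompact {v' : Sob d s (ZMod n) | ∃ v ∈ 𝒱, IsSampling p v v'}) ∧
    -- the sets of truncated Fourier representatives are compact
    (∀ K : ℕ,
      IsCompact (spec K '' V) ∧
      IsCompact ((fun v => pDFT (spec K v)) '' V) ∧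
      (∀ i : Modes d K, IsCompact ((fun v => spec K v i) '' V)) ∧
      (∀ (S : Finset (ZMod n)) (i : Modes d K),
        IsCompact ((fun v => dftP (dropout S (spec K v i))) '' V))) ∧
    -- Fourier-conjugate decomposition through continuous conjugate maps
    (∀ K : ℕ,
      Continuous (conjMap K M) ∧ Continuous (conjMapP K M) ∧
      ∀ v, projL2 K (M (proj K v)) = synth (conjMap K M (spec K v)) ∧
        projL2 K (M (proj K v)) = synth (pDFTInv (conjMapP K M (pDFT (spec K v))))) ∧
    TendstoUniformlyOn (fun K v => projL2 K (M (proj K v))) M atTop V ∧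
    -- approximating the truncated operator is approximating its conjugate maps:
    -- the errors agree
    (∀ (K : ℕ) (N : Sob d s (ZMod n) → L2 d (ZMod n)) (v : Sob d s (ZMod n)),
      ‖projL2 K (M (proj K v)) - projL2 K (N (proj K v))‖ ^ 2
          = ∑ i, ‖conjMap K M (spec K v) i - conjMap K N (spec K v) i‖ ^ 2 ∧
      (n : ℝ) * ‖projL2 K (M (proj K v)) - projL2 K (N (proj K v))‖ ^ 2
          = ∑ i, ‖conjMapP K M (pDFT (spec K v)) i - conjMapP K N (pDFT (spec K v)) i‖ ^ 2) ∧
    -- the same for families of operators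
    (∀ (K : ℕ) (α : Type) (l : Filter α) (N : α → Sob d s (ZMod n) → L2 d (ZMod n)),
      (TendstoUniformlyOn (fun a v => projL2 K (N a (proj K v)))
          (fun v => projL2 K (M (proj K v))) l V ↔
        ∀ i, TendstoUniformlyOn (fun a c => conjMap K (N a) c i) (fun c => conjMap K M c i) l
          (spec K '' V)) ∧
      (TendstoUniformlyOn (fun a v => projL2 K (N a (proj K v)))
          (fun v => projL2 K (M (proj K v))) l V ↔
        ∀ i, TendstoUniformlyOn (fun a c => conjMapP K (N a) c i) (fun c => conjMapP K M c i) l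
          ((fun v => pDFT (spec K v)) '' V))) ∧
    -- approximating `M` itself by operators built from coefficient maps of any given classes
    -- is approximating the conjugate maps by these coefficient maps
    (∀ 𝒞 : ∀ K : ℕ, Set (Coeff d K (ZMod n) → Coeff d K (ZMod n)),
      (∀ K, ∀ Φ ∈ 𝒞 K, ∀ c ∈ spec K '' V, IsHermitian (Φ c)) →
      ((∀ ε > 0, ∃ K₀, ∀ K ≥ K₀, ∃ Φ ∈ 𝒞 K, ∀ v ∈ V, ‖M v - coeffOp Φ v‖ ≤ ε) ↔
        ∀ ε > 0, ∃ K₀, ∀ K ≥ K₀, ∃ Φ ∈ 𝒞 K, ∀ c ∈ spec K '' V, ‖conjMap K M c - Φ c‖ ≤ ε) ∧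
      ((∀ ε > 0, ∃ K₀, ∀ K ≥ K₀, ∃ Φ ∈ 𝒞 K, ∀ v ∈ V, ‖M v - coeffOp Φ v‖ ≤ ε) ↔
        ∀ ε > 0, ∃ K₀, ∀ K ≥ K₀, ∃ Φ ∈ 𝒞 K, ∀ c ∈ (fun v => pDFT (spec K v)) '' V,
          ‖conjMapP K M c - pDFT (Φ (pDFTInv c))‖ ≤ ε)) ∧
    -- the forward transforms are approximated by neural operators on bounded sets
    (∀ (K : ℕ) (R ε : ℝ), 0 < ε →
      (∃ N, ComputesCoeff σ arch N (Metric.closedBall (0 : L2 d (ZMod n)) R)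
        (fun v => fwd K (projL2 K v)) ε) ∧
      (∃ N, ComputesCoeff σ arch N (Metric.closedBall (0 : L2 d (ZMod n)) R)
        (fun v => pDFT (fwd K (projL2 K v))) ε)) ∧
    -- the inverse transforms are approximated by neural operators on bounded sets
    (∀ (K : ℕ) (R ε : ℝ), 0 < ε →
      (∃ N, ComputesFun σ arch N (Metric.closedBall (0 : Coeff d K (ZMod n)) R) synth ε) ∧
      (∃ N, ComputesFun σ arch N (Metric.closedBall (0 : Coeff d K (ZMod n)) R)
        (fun c => synth (pDFTInv c)) ε)) ∧
    -- the conjugate maps are approximated by neural networks on the compact coefficient sets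
    (∀ (K : ℕ) (i : Modes d K) (ε : ℝ), 0 < ε →
      (∃ Φ : NN ((Modes d K × ZMod n) × Bool) (ZMod n × Bool), ∀ c ∈ spec K '' V,
        ‖complexify (Φ.eval σ (enc c)) - conjMap K M c i‖ ≤ ε) ∧
      (∃ Φ : NN ((Modes d K × ZMod n) × Bool) (ZMod n × Bool),
        ∀ c ∈ (fun v => pDFT (spec K v)) '' V,
          ‖complexify (Φ.eval σ (enc c)) - conjMapP K M c i‖ ≤ ε)) ∧
    -- if the conjugate map acts mode by mode, then so do the networks, on the coefficient set of
    -- each mode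
    (∀ (K : ℕ) (m : Modes d K → EuclideanSpace ℂ (ZMod n) → EuclideanSpace ℂ (ZMod n)),
      (∀ v ∈ V, ∀ i, conjMap K M (spec K v) i = m i (spec K v i)) →
      ∀ ε > 0, ∃ Φ : Modes d K → NN (ZMod n × Bool) (ZMod n × Bool),
        (∀ i, ∀ z ∈ (fun v => spec K v i) '' V,
          ‖complexify ((Φ i).eval σ (realify z)) - m i z‖ ≤ ε) ∧
        ∀ v ∈ V, ‖projL2 K (M (proj K v)) - coeffOp (K := K) (fun c => WithLp.toLp 2 fun i =>
          complexify ((Φ i).eval σ (realify (c i)))) v‖ ≤ ε) ∧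
    (∀ (K : ℕ) (m : Modes d K → EuclideanSpace ℂ (ZMod n) → EuclideanSpace ℂ (ZMod n)),
      (∀ v ∈ V, ∀ i, conjMapP K M (pDFT (spec K v)) i = m i (dftP (spec K v i))) →
      ∀ ε > 0, ∃ Φ : Modes d K → NN (ZMod n × Bool) (ZMod n × Bool),
        (∀ i, ∀ z ∈ (fun v => dftP (spec K v i)) '' V,
          ‖complexify ((Φ i).eval σ (realify z)) - m i z‖ ≤ ε) ∧
        ∀ v ∈ V, ‖projL2 K (M (proj K v)) - coeffOp (K := K) (fun c => pDFTInv (WithLp.toLp 2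
          fun i => complexify ((Φ i).eval σ (realify (dftP (c i)))))) v‖ ≤ ε) ∧
    -- hence `M` is approximated by (approximate forward transform, then network for the conjugate
    -- map, then approximate inverse transform), which is one neural operator; first without and
    -- then with the further transform in `p`
    (∀ ε > 0, ∃ K₀, ∀ K ≥ K₀,
      ∃ (F : NeuralOp d (ZMod n) ((Modes d K × ZMod n) × Bool))
        (Φ : NN ((Modes d K × ZMod n) × Bool) ((Modes d K × ZMod n) × Bool))
        (G : NeuralOp d ((Modes d K × ZMod n) × Bool) (ZMod n)),
        ComputesCoeff σ arch F (Sob.toL2 '' V) (fun v => fwd K (projL2 K v)) ε ∧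
        (∀ c ∈ spec K '' V, ‖Φ.eval σ (enc c) - enc (conjMap K M c)‖ ≤ ε) ∧
        ComputesFun σ arch G (conjMap K M '' (spec K '' V)) synth ε ∧
        ∀ v ∈ V, eLpNorm (fun x => (F.comp ((Φ.toOp d).comp G)).app σ arch v.toL2 x - M v x) 2
          (haarT d) ≤ ENNReal.ofReal ε) ∧
    (∀ ε > 0, ∃ K₀, ∀ K ≥ K₀,
      ∃ (F : NeuralOp d (ZMod n) ((Modes d K × ZMod n) × Bool))
        (Φ : NN ((Modes d K × ZMod n) × Bool) ((Modes d K × ZMod n) × Bool))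
        (G : NeuralOp d ((Modes d K × ZMod n) × Bool) (ZMod n)),
        ComputesCoeff σ arch F (Sob.toL2 '' V) (fun v => pDFT (fwd K (projL2 K v))) ε ∧
        (∀ c ∈ (fun v => pDFT (spec K v)) '' V,
          ‖Φ.eval σ (enc c) - enc (conjMapP K M c)‖ ≤ ε) ∧
        ComputesFun σ arch G (conjMapP K M '' ((fun v => pDFT (spec K v)) '' V))
          (fun c => synth (pDFTInv c)) ε ∧
        ∀ v ∈ V, eLpNorm (fun x => (F.comp ((Φ.toOp d).comp G)).app σ arch v.toL2 x - M v x) 2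
          (haarT d) ≤ ENNReal.ofReal ε) := by
  -- Of the activation, the argument needs only continuity and that it is not a polynomial.
  have hc : Continuous σ := by
    obtain ⟨L, hL⟩ := hσL
    exact hL.continuous
  have hpcont : ∀ K, Continuous fun v : Sob d s (ZMod n) => pDFT (spec K v) := fun K =>
    continuous_pDFT.comp continuous_spec
  have hfin : ∀ {K : ℕ} (T : L2 d (ZMod n) → Coeff d K (ZMod n))
      (τ : Coeff d K (ZMod n) → Coeff d K (ZMod n)), Continuous τ →
      (∀ v : L2 d (ZMod n), T v = τ (fwd K v)) → ∀ R ε : ℝ, 0 < ε →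
      ∃ N, ComputesCoeff σ arch N (Metric.closedBall (0 : L2 d (ZMod n)) R) T ε := by
    intro K T τ hτ hT R ε hε
    obtain ⟨N, hN⟩ := NeuralOp.exists_approx_forward hc hσ arch
      (τ := fun y => enc (τ (dec (ZMod n) y)))
      (continuous_enc.comp (hτ.comp continuous_dec)) R hε
    refine ⟨N, fun v hv => ?_⟩
    obtain ⟨y, hy, hy'⟩ := hN v (mem_closedBall_zero_iff.1 hv)
    refine ⟨y, ae_of_all _ hy, ?_⟩
    rwa [dec_enc, ← hT] at hy'
  have hinv : ∀ {K : ℕ} (τ : Coeff d K (ZMod n) → Coeff d K (ZMod n)), Continuous τ →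
      ∀ R ε : ℝ, 0 < ε → ∃ N, ComputesFun σ arch N
        (Metric.closedBall (0 : Coeff d K (ZMod n)) R) (fun c => synth (τ c)) ε := by
    intro K τ hτ R ε hε
    obtain ⟨N, hN⟩ := NeuralOp.exists_approx_inverse hc hσ arch hτ R hε
    exact ⟨N, fun c hcR => eLpNorm_sub_synth_le hε.le (hN c (mem_closedBall_zero_iff.1 hcR))⟩
  have hnet : ∀ {K : ℕ} (i : Modes d K) (Z : Set (Coeff d K (ZMod n))), IsCompact Z →
      ∀ (Q : Coeff d K (ZMod n) → Coeff d K (ZMod n)), Continuous Q → ∀ ε : ℝ, 0 < ε →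
      ∃ Φ : NN ((Modes d K × ZMod n) × Bool) (ZMod n × Bool), ∀ c ∈ Z,
        ‖complexify (Φ.eval σ (enc c)) - Q c i‖ ≤ ε := by
    intro K i Z hZ Q hQ ε hε
    obtain ⟨Φ, hΦ⟩ := NN.exists_enc_approx hc hσ hZ (m := fun c => realify (Q c i))
      (continuous_realify.comp ((PiLp.continuous_apply 2 _ i).comp hQ)) hε
    refine ⟨Φ, fun c hcZ => ?_⟩
    have := hΦ c hcZ
    rwa [← realify_complexify (Φ.eval σ (enc c)), ← realify_sub, norm_realify] at this
  refine ⟨?_, ?_, ?_, tendstoUniformlyOn_projL2_proj hV hM, ?_, ?_, ?_, ?_, ?_, ?_, ?_, ?_, ?_, ?_⟩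
  · intro r hr p 𝒱 h𝒱
    refine ⟨fun v _ => ?_, isCompact_samplings hs hr p h𝒱⟩
    obtain ⟨v', hv'⟩ := exists_isSampling (s := s) hs hr p v
    exact ⟨v', hv', fun w hw => hw.unique hv'⟩
  · intro K
    refine ⟨hV.image continuous_spec, hV.image (hpcont K), fun i => hV.image ?_,
      fun S i => hV.image ?_⟩
    · exact (PiLp.continuous_apply 2 _ i).comp continuous_spec
    · exact continuous_dftP.comp ((continuous_dropout S).comp
        ((PiLp.continuous_apply 2 _ i).comp continuous_spec))
  · refine fun K => ⟨continuous_conjMap hM, continuous_conjMapP hM, fun v => ?_⟩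
    rw [conjMapP_pDFT, pDFTInv_pDFT]
    exact ⟨projL2_proj_eq M v, projL2_proj_eq M v⟩
  · intro K N v
    rw [norm_projL2_sub]
    constructor
    · rw [PiLp.norm_sq_eq_of_L2]
      rfl
    · rw [← norm_sq_pDFT, pDFT_sub, ← conjMapP_pDFT, ← conjMapP_pDFT, PiLp.norm_sq_eq_of_L2]
      rfl
  · intro K α l N
    rw [tendstoUniformlyOn_projL2_iff]
    constructor
    · rw [← tendstoUniformlyOn_piLp, tendstoUniformlyOn_image]
    · rw [← tendstoUniformlyOn_piLp, tendstoUniformlyOn_image]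
      simp only [conjMapP_pDFT]
      rw [tendstoUniformlyOn_pDFT_iff]
  · intro 𝒞 h𝒞
    have h1 := approx_iff_conjMap_approx hV hM 𝒞 h𝒞
    exact ⟨h1, h1.trans (conjMap_approx_iff_conjMapP_approx 𝒞)⟩
  · intro K R ε hε
    exact ⟨hfin _ id continuous_id (fun v => fwd_projL2 v) R ε hε,
      hfin _ pDFT continuous_pDFT (fun v => congrArg pDFT (fwd_projL2 v)) R ε hε⟩
  · intro K R ε hε
    exact ⟨hinv id continuous_id R ε hε, hinv pDFTInv continuous_pDFTInv R ε hε⟩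
  · intro K i ε hε
    exact ⟨hnet i _ (hV.image continuous_spec) _ (continuous_conjMap hM) ε hε,
      hnet i _ (hV.image (hpcont K)) _ (continuous_conjMapP hM) ε hε⟩
  · intro K m hm ε hε
    obtain ⟨Φ, hΦ, hΦ'⟩ := NN.exists_modewise_approx hc hσ hV (p := spec K) continuous_spec
      (q := fun v => conjMap K M (spec K v)) ((continuous_conjMap hM).comp continuous_spec)
      hm (synthL d K (ZMod n)) hε
    refine ⟨Φ, hΦ, fun v hv => ?_⟩
    rw [projL2_proj_eq]
    exact hΦ' v hv
  · intro K m hm ε hε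
    -- Synthesis preceded by the inverse transform in `p` is still real-linear, so the same
    -- mode-by-mode lemma applies.
    obtain ⟨Φ, hΦ, hΦ'⟩ := NN.exists_modewise_approx hc hσ hV (p := fun v => pDFT (spec K v))
      (hpcont K) (q := fun v => conjMapP K M (pDFT (spec K v)))
      ((continuous_conjMapP hM).comp (hpcont K)) hm (synthL d K (ZMod n) ∘ₗ pDFTInvL d K n) hε
    refine ⟨Φ, hΦ, fun v hv => ?_⟩
    have h1 : projL2 K (M (proj K v)) = synth (pDFTInv (conjMapP K M (pDFT (spec K v)))) := by
      rw [conjMapP_pDFT, pDFTInv_pDFT, projL2_proj_eq]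
    rw [h1]
    exact hΦ' v hv
  · intro ε hε
    exact NeuralOp.exists_approx_operator hc hσ arch hs hV hM (T := fun _ => id)
      (T' := fun _ => id) (Q := fun K => conjMap K M) (fun _ => continuous_id)
      (fun _ => continuous_id) (fun _ => continuous_conjMap hM)
      (fun K v => (projL2_proj_eq M v).symm) hε
  · intro ε hε
    refine NeuralOp.exists_approx_operator hc hσ arch hs hV hM (T := fun _ => pDFT)
      (T' := fun _ => pDFTInv) (Q := fun K => conjMapP K M) (fun _ => continuous_pDFT)
      (fun _ => continuous_pDFTInv) (fun _ => continuous_conjMapP hM) (fun K v => ?_) hε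
    rw [conjMapP_pDFT, pDFTInv_pDFT, projL2_proj_eq]
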